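/- Let $X$ be a compact connected translation surface with a finite non-empty set $\Sigma$ of singularities and marked points, let $\zeta : H_1(X\setminus\Sigma,\mathbb Z)\to\mathbb Z^d$ be a homomorphism, and let $p : X_\Gamma\to X\setminus\Sigma$ be the associated connected $\mathbb Z^d$-cover (so $\zeta$ is onto and the deck group is $\{\Delta_{n}\}_{n\in\mathbb Z^d}$), with the translation structure pulled back by $p$. A direction $\theta$ (a unit vector) on a translation surface is called periodic if the surface is the union of the closures of the maximal flat cylinders in direction $\theta$ and the moduli (width over height, the width being the length of the closed orbits) of these cylinders have rational pairwise ratios; it has finite horizon on $X_\Gamma$ if $X_\Gamma$ contains no infinite (complete, non-closed) straight line in direction $\theta$. If $\theta$ is periodic on $X$, a Dehn twist with parameter $\mu\neq 0$ in direction $\theta$ is a homeomorphism of $X$ which preserves $\Sigma$, is affine on $X\setminus\Sigma$ with derivative $\begin{pmatrix}1&\mu\\0&1\end{pmatrix}$ in the basis $(\theta,i\theta)$, and maps each maximal cylinder $(\mathbb R/w\mathbb Z)\times(0,h)$ in direction $\theta$ to itself by $(s,t)\mapsto(s+\mu t,t)$, where $\mu=k\,w/h$ for an integer $k$ depending on the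 cylinder. A linear pseudo-Anosov map is a homeomorphism of $X$ preserving $\Sigma$ and affine on $X\setminus\Sigma$ with constant derivative of determinant $1$ and trace larger than $2$. Suppose that $X_\Gamma$ has finite horizon and is periodic in each of two non-parallel directions $\theta_1,\theta_2$. Then: 1. there exist Dehn twists $D_1$, $D_2$ of $X$ in the directions $\theta_1$, $\theta_2$, with parameters $\mu_1>0$ and $\mu_2<0$ (in particular $\theta_1,\theta_2$ are periodic on $X$); 2. every Dehn twist $D$ of $X$ in direction $\theta_1$ or $\theta_2$ preserves $\zeta$, i.e. $\zeta\circ D_*=\zeta$, and lifts to a homeomorphism of $X_\Gamma$ commuting with all deck transformations; 3. for all Dehn twists $D_1$, $D_2$ in the directions $\theta_1$, $\theta_2$ whose parameters have opposite signs, the composition $\psi=D_1\circ D_2$ is a linear pseudo-Anosov map of $X$ with $\zeta\circ\psi_*=\zeta$, and $\psi$ lifts to a homeomorphism of $X_\Gamma$ commuting with all deck transformations. In particular there is a pseudo-Anosov map $\psi$ on $X$ which preserves $\zeta$. -/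

import Mathlib

open Filter Topology Set

noncomputable section

/-- A translation structure on a surface `Y` (possibly of infinite area): an atlas of charts with
values in `ℂ` whose transition maps are locally translations. -/
structure TranslationStructure (Y : Type*) [TopologicalSpace Y] where
  atlas : Set (OpenPartialHomeomorph Y ℂ)
  cover : ∀ y : Y, ∃ e ∈ atlas, y ∈ e.source
  compat : ∀ e ∈ atlas, ∀ e' ∈ atlas, ∀ y ∈ e.source ∩ e'.source,
    ∃ c : ℂ, ∀ᶠ z in 𝓝 y, e' z = e z + c

namespace TranslationStructure

variable {Y : Type*} [TopologicalSpace Y]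

/-- The pull-back of a translation structure by a local homeomorphism `q`: the charts are those
which agree locally, up to translation, with `q` followed by a chart downstairs. -/
def pullback (T : TranslationStructure Y) {E : Type*} [TopologicalSpace E] (q : E → Y)
    (hq : IsLocalHomeomorph q) : TranslationStructure E where
  atlas := {a | ∀ x ∈ a.source, ∀ e ∈ T.atlas, q x ∈ e.source →
    ∃ c : ℂ, ∀ᶠ z in 𝓝 x, a z = e (q z) + c}
  cover := by
    intro x
    obtain ⟨b, hb, hqb⟩ := hq x
    obtain ⟨e, he, hxe⟩ := T.cover (q x)
    refine ⟨b.trans e, ?_, ?_⟩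
    · intro y hy e' he' hye'
      rw [OpenPartialHomeomorph.trans_source] at hy
      have hy2 : q y ∈ e.source := by rw [hqb]; exact hy.2
      obtain ⟨c, hc⟩ := T.compat e' he' e he (q y) ⟨hye', hy2⟩
      refine ⟨c, ?_⟩
      have := (hq.continuous.tendsto y).eventually hc
      filter_upwards [this] with z hz
      rw [← hz, hqb]
      rfl
    · rw [OpenPartialHomeomorph.trans_source]
      refine ⟨hb, ?_⟩
      have : b x ∈ e.source := by rw [← hqb]; exact hxe
      exact this
  compat := by
    intro a ha a' ha' x hx
    obtain ⟨e, he, hxe⟩ := T.cover (q x)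
    obtain ⟨c, hc⟩ := ha x hx.1 e he hxe
    obtain ⟨c', hc'⟩ := ha' x hx.2 e he hxe
    refine ⟨c' - c, ?_⟩
    filter_upwards [hc, hc'] with z hz hz'
    rw [hz, hz']
    ring

/-- `ℓ` is a complete straight line, run at unit speed in the direction of the unit vector `θ`. -/
def IsLine (T : TranslationStructure Y) (θ : ℂ) (l : ℝ → Y) : Prop :=
  Continuous l ∧ ∀ t : ℝ, ∀ e ∈ T.atlas, l t ∈ e.source →
    ∃ c : ℂ, ∀ᶠ s in 𝓝 t, e (l s) = (s : ℂ) * θ + c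

/-- The direction `θ` has finite horizon: no infinite (that is, complete and non-closed) straight
line in that direction. -/
def HasFiniteHorizon (T : TranslationStructure Y) (θ : ℂ) : Prop :=
  ¬ ∃ l : ℝ → Y, T.IsLine θ l ∧ Function.Injective l

/-- An open flat cylinder in direction `θ` (a unit vector): an embedding of
`(ℝ / width ℤ) × (0, height)` which in charts is, up to translation,
`(s, t) ↦ s θ + t i θ`. The values of `param` off the strip `0 < t < height` play no role. -/
structure Cylinder (T : TranslationStructure Y) (θ : ℂ) where
  width : ℝ
  height : ℝ
  width_pos : 0 < width
  height_pos : 0 < height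
  param : ℝ × ℝ → Y
  continuousOn : ContinuousOn param (univ ×ˢ Ioo 0 height)
  flat : ∀ x ∈ (univ : Set ℝ) ×ˢ Ioo 0 height, ∀ e ∈ T.atlas, param x ∈ e.source →
    ∃ c : ℂ, ∀ᶠ z in 𝓝 x, e (param z) = ((z.1 : ℂ) + (z.2 : ℂ) * Complex.I) * θ + c
  eq_iff : ∀ x ∈ (univ : Set ℝ) ×ˢ Ioo 0 height, ∀ z ∈ (univ : Set ℝ) ×ˢ Ioo 0 height,
    (param x = param z ↔ x.2 = z.2 ∧ ∃ n : ℤ, x.1 = z.1 + n * width)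

namespace Cylinder

variable {T : TranslationStructure Y} {θ : ℂ}

/-- The open subset of the surface filled by the cylinder. -/
def carrier (C : T.Cylinder θ) : Set Y := C.param '' (univ ×ˢ Ioo 0 C.height)

/-- The modulus: width (length of the closed orbits) over height. -/
def modulus (C : T.Cylinder θ) : ℝ := C.width / C.height

/-- A maximal cylinder: it cannot be enlarged, so that its boundary consists of saddle
connections. -/
def IsMaximal (C : T.Cylinder θ) : Prop :=
  ∀ C' : T.Cylinder θ, C.carrier ⊆ C'.carrier → C'.carrier = C.carrier

end Cylinder

/-- The direction `θ` is periodic: the surface is the union of the closures of the maximal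
cylinders in that direction, and these have pairwise commensurable moduli. -/
def IsPeriodic (T : TranslationStructure Y) (θ : ℂ) : Prop :=
  (∀ y : Y, ∃ C : T.Cylinder θ, C.IsMaximal ∧ y ∈ closure C.carrier) ∧
  ∀ C C' : T.Cylinder θ, C.IsMaximal → C'.IsMaximal → ∃ r : ℚ, C.modulus = r * C'.modulus

/-- `f` is affine in the charts, with constant derivative `A`. -/
def IsAffineWith (T : TranslationStructure Y) (f : Y → Y) (A : ℂ →ₗ[ℝ] ℂ) : Prop :=
  ∀ y : Y, ∀ e ∈ T.atlas, ∀ e' ∈ T.atlas, y ∈ e.source → f y ∈ e'.source →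
    ∃ c : ℂ, ∀ᶠ z in 𝓝 y, e' (f z) = A (e z) + c

end TranslationStructure

/-- A translation surface on the (compact, connected, Hausdorff) space `X`: a finite non-empty set
`sing` of singularities and marked points, a translation structure on its complement, and around
each point of `sing` a coordinate `φ` in which the flat coordinates are `φ ^ k` up to translation
(a cone point of angle `2 π k`, with `k = 1` for a marked point). -/
structure TranslationSurface (X : Type*) [TopologicalSpace X] where
  sing : Set X
  sing_finite : sing.Finite
  sing_nonempty : sing.Nonempty
  flat : TranslationStructure {x : X // x ∉ sing}
  cone : ∀ p ∈ sing, ∃ k : ℕ, 1 ≤ k ∧ ∃ φ : OpenPartialHomeomorph X ℂ,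
    p ∈ φ.source ∧ φ p = 0 ∧
    ∀ y : {x : X // x ∉ sing}, (y : X) ∈ φ.source → ∀ e ∈ flat.atlas, y ∈ e.source →
      ∃ c : ℂ, ∀ᶠ z in 𝓝 y, e z = φ (z : X) ^ k + c

/-- The first integral homology group of a path-connected space, as the abelianized fundamental
group. -/
abbrev FirstHomology (Y : Type*) [TopologicalSpace Y] (x₀ : Y) : Type _ :=
  Additive (Abelianization (FundamentalGroup Y x₀))

/-- The homology class of a loop `γ` at `y`, moved to the base point along a path `δ`. The class
does not depend on `δ`. -/
def loopClass {Y : Type*} [TopologicalSpace Y] {x₀ y : Y} (δ : Path x₀ y) (γ : Path y y) :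
    FirstHomology Y x₀ :=
  Additive.ofMul (Abelianization.of
    (FundamentalGroup.fromPath (Path.Homotopic.Quotient.mk ((δ.trans γ).trans δ.symm))))

/-- `ζ ∘ f_* = ζ` on first homology. -/
def PreservesHom {Y : Type*} [TopologicalSpace Y] {x₀ : Y} {d : ℕ}
    (ζ : FirstHomology Y x₀ →+ (Fin d → ℤ)) (f : Y ≃ₜ Y) : Prop :=
  ∀ (y : Y) (γ : Path y y) (δ : Path x₀ y) (δ' : Path x₀ (f y)),
    ζ (loopClass δ' (γ.map f.continuous)) = ζ (loopClass δ γ)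

/-- `E` is the (connected) `ℤ^d`-cover of `Y` defined by `ζ`: a covering whose fibres are the
orbits of an action of `ℤ^d` by deck transformations, such that `ζ` of a loop of `Y` is `n`
whenever the loop lifts to a path from a point `e` to its translate by `n`. (In particular a loop
lifts to a loop exactly when `ζ` vanishes on it, and `ζ` is onto.) -/
structure ZdCover {Y : Type*} [TopologicalSpace Y] {x₀ : Y} {d : ℕ}
    (ζ : FirstHomology Y x₀ →+ (Fin d → ℤ)) (E : Type*) [TopologicalSpace E] where
  pathConnected : PathConnectedSpace E
  proj : E → Y
  isCoveringMap : IsCoveringMap proj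
  surjective : Function.Surjective proj
  deck : (Fin d → ℤ) → E ≃ₜ E
  deck_add : ∀ (m n : Fin d → ℤ) (x : E), deck (m + n) x = deck m (deck n x)
  fibre : ∀ x x' : E, proj x = proj x' ↔ ∃ n, deck n x = x'
  monodromy : ∀ (x : E) (n : Fin d → ℤ) (γ' : Path x (deck n x)) (γ : Path (proj x) (proj x))
    (δ : Path x₀ (proj x)), (∀ t, γ t = proj (γ' t)) → ζ (loopClass δ γ) = n

namespace ZdCover

variable {Y : Type*} [TopologicalSpace Y] {x₀ : Y} {d : ℕ}
  {ζ : FirstHomology Y x₀ →+ (Fin d → ℤ)} {E : Type*} [TopologicalSpace E]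

/-- The translation structure of the cover. -/
def flat (P : ZdCover ζ E) (T : TranslationStructure Y) : TranslationStructure E :=
  T.pullback P.proj P.isCoveringMap.isLocalHomeomorph

/-- `f` lifts to a homogeneous homeomorphism of the cover: one that commutes with all deck
transformations. -/
def HasHomogeneousLift (P : ZdCover ζ E) (f : Y ≃ₜ Y) : Prop :=
  ∃ F : E ≃ₜ E, (∀ x, P.proj (F x) = f (P.proj x)) ∧ ∀ n x, F (P.deck n x) = P.deck n (F x)

end ZdCover

/-- The linear map `v ↦ v + μ h(v) θ`, where `h(v)` is the coordinate of `v` along `i θ`, for a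
unit vector `θ`. In the basis `θ, i θ` its matrix is `(1 μ; 0 1)`. -/
def parabolicMap (θ : ℂ) (μ : ℝ) : ℂ →ₗ[ℝ] ℂ where
  toFun v := v + ((μ * (starRingEnd ℂ θ * v).im : ℝ) : ℂ) * θ
  map_add' v w := by
    simp only [mul_add, Complex.add_im]
    push_cast
    ring
  map_smul' r v := by
    simp only [RingHom.id_apply, Complex.real_smul]
    rw [mul_left_comm, Complex.im_ofReal_mul]
    push_cast
    ring

namespace TranslationSurface

variable {X : Type*} [TopologicalSpace X]

/-- The complement of the singularities and marked points. -/
abbrev Reg (S : TranslationSurface X) : Type _ := {x : X // x ∉ S.sing}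

/-- The group (under composition) of the homeomorphisms of `X` that preserve the set `sing`. -/
def HomeoGroup (S : TranslationSurface X) : Subgroup (X ≃ₜ X) where
  carrier := {f | ∀ x, x ∉ S.sing ↔ f x ∉ S.sing}
  one_mem' := fun _ => Iff.rfl
  mul_mem' := by
    intro f g hf hg x
    exact (hg x).trans (hf (g x))
  inv_mem' := by
    intro f hf x
    have h := hf (f.symm x)
    rw [f.apply_symm_apply] at h
    exact h.symm

/-- The restriction of such a homeomorphism to the complement of `sing`. -/
def onReg (S : TranslationSurface X) (f : S.HomeoGroup) : S.Reg ≃ₜ S.Reg :=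
  (f : X ≃ₜ X).subtype f.2

/-- `f` is a linear pseudo-Anosov map: a linear automorphism of the translation surface whose
matrix has determinant `1` and trace larger than `2`. -/
def IsPseudoAnosov (S : TranslationSurface X) (f : S.HomeoGroup) : Prop :=
  ∃ A : ℂ →ₗ[ℝ] ℂ, S.flat.IsAffineWith (S.onReg f) A ∧
    LinearMap.det A = 1 ∧ 2 < LinearMap.trace ℝ ℂ A

/-- `f` is the product of Dehn twists in the periodic direction `θ` with parameter `μ`: a linear
automorphism with matrix `(1 μ; 0 1)` in the basis `θ, i θ`, which maps each maximal cylinder in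
direction `θ` to itself as a power `k ≠ 0` of the affine Dehn twist, where `k` times the modulus of
the cylinder is `μ`. -/
def IsDehnTwist (S : TranslationSurface X) (θ : ℂ) (μ : ℝ) (f : S.HomeoGroup) : Prop :=
  μ ≠ 0 ∧ S.flat.IsPeriodic θ ∧ S.flat.IsAffineWith (S.onReg f) (parabolicMap θ μ) ∧
    ∀ C : S.flat.Cylinder θ, C.IsMaximal → (∃ k : ℤ, k * C.modulus = μ) ∧
      ∀ s : ℝ, ∀ t ∈ Ioo 0 C.height, S.onReg f (C.param (s, t)) = C.param (s + μ * t, t)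

end TranslationSurface

end

/-! Fix a periodic direction of the cover. A maximal cylinder upstairs embeds into the base. Its
image is a horizontally periodic flat strip; if the strip came back to itself at another height it
would close up to a compact open torus, impossible in a connected non-compact surface. If the
horizontal period dropped to an `n`-th part, some deck transformation `m` would act on the cylinder
as the shorter translation, so `n • m` would fix a point; the action is free and `ℤ^d` is
torsion-free, so `m = 0` and nothing dropped (`proj_param_eq_iff`). The image is again maximal,
because a larger flat strip downstairs lifts to the cover and keeps its period. Hence the direction
is periodic on the base with the same moduli (`isPeriodic_base`).

The base has only finitely many maximal cylinders (`finite_maximal_carriers`): in each of them some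
vertical ray descends to a point of `sing`, and at a cone point of angle `2πk` only `k` cylinders
can do so. Their moduli therefore have a common integer multiple `μ`. Shearing every maximal
cylinder with parameter `μ` and fixing all other points defines `twist`. It is continuous, since a
regular point off the cylinders has one cylinder above and one below, and at the top edge of a
cylinder the shear is a whole number of turns (`isLocallyShear_twist`). It extends over the
punctures, which gives the Dehn twists; by density, each Dehn twist restricts to `twist` on the
regular part.

The same recipe with the same `μ` defines a twist of the cover. It lies over the one downstairs, and
it commutes with deck transformations because these permute the maximal cylinders. Such a lift
carries a path from `x` to its translate by `n` to a path from the image of `x` to the translate of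
that image by `n`, so `ζ` is preserved. Finally a product of two twists has determinant `1` and
trace `2 - μ₁ μ₂ c²`, with `c ≠ 0` the cross product of the directions. -/

noncomputable section

/-! ### Flat maps from the plane into a translation surface -/

namespace TranslationStructure

variable {Y : Type*} [TopologicalSpace Y] {T : TranslationStructure Y} {θ : ℂ}

/-- The developing map of the plane with horizontal direction `θ`. -/
def dev (θ : ℂ) (z : ℝ × ℝ) : ℂ := ((z.1 : ℂ) + (z.2 : ℂ) * Complex.I) * θ

theorem dev_add (θ : ℂ) (z w : ℝ × ℝ) : dev θ (z + w) = dev θ z + dev θ w := by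
  simp [dev]; ring

@[simp] theorem dev_zero (θ : ℂ) : dev θ 0 = 0 := by simp [dev]

/-- `dev` as a homeomorphism. -/
def devHomeo (θ : ℂ) (hθ : θ ≠ 0) : ℝ × ℝ ≃ₜ ℂ :=
  Complex.equivRealProdCLM.symm.toHomeomorph.trans (Homeomorph.mulRight₀ θ hθ)

theorem devHomeo_apply (θ : ℂ) (hθ : θ ≠ 0) (z : ℝ × ℝ) : devHomeo θ hθ z = dev θ z := by
  simp [devHomeo, dev, Complex.equivRealProdCLM_symm_apply]

theorem coe_devHomeo (θ : ℂ) (hθ : θ ≠ 0) : ⇑(devHomeo θ hθ) = dev θ :=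
  funext (devHomeo_apply θ hθ)

theorem continuous_dev (θ : ℂ) : Continuous (dev θ) := by unfold dev; fun_prop

theorem dev_injective (hθ : θ ≠ 0) : Function.Injective (dev θ) := by
  rw [← coe_devHomeo θ hθ]; exact (devHomeo θ hθ).injective

/-- A flat map from `U ⊆ ℝ × ℝ` to the surface: in charts it is `dev θ` up to translation. -/
def FlatOn (T : TranslationStructure Y) (θ : ℂ) (U : Set (ℝ × ℝ)) (f : ℝ × ℝ → Y) : Prop :=
  ContinuousOn f U ∧ ∀ x ∈ U, ∀ e ∈ T.atlas, f x ∈ e.source →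
    ∃ c : ℂ, ∀ᶠ z in 𝓝 x, e (f z) = dev θ z + c

namespace FlatOn

variable {U V : Set (ℝ × ℝ)} {f g : ℝ × ℝ → Y}

theorem mono (hf : T.FlatOn θ U f) (h : V ⊆ U) : T.FlatOn θ V f :=
  ⟨hf.1.mono h, fun x hx => hf.2 x (h hx)⟩

theorem congr_of_isOpen (hU : IsOpen U) (hf : T.FlatOn θ U f) (h : EqOn g f U) :
    T.FlatOn θ U g := by
  refine ⟨hf.1.congr h, fun x hx e he hxe => ?_⟩
  rw [h hx] at hxe
  obtain ⟨c, hc⟩ := hf.2 x hx e he hxe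
  refine ⟨c, ?_⟩
  filter_upwards [hc, hU.mem_nhds hx] with z hz hz'
  rw [h hz', hz]

theorem of_locally (h : ∀ x ∈ U, ∃ V g, IsOpen V ∧ x ∈ V ∧ T.FlatOn θ V g ∧ EqOn f g V) :
    T.FlatOn θ U f := by
  refine ⟨fun x hx => ?_, fun x hx e he hxe => ?_⟩
  · obtain ⟨V, g, hV, hxV, hg, hfg⟩ := h x hx
    exact ((congr_of_isOpen hV hg hfg).1.continuousAt (hV.mem_nhds hxV)).continuousWithinAt
  · obtain ⟨V, g, hV, hxV, hg, hfg⟩ := h x hx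
    exact (congr_of_isOpen hV hg hfg).2 x hxV e he hxe

theorem comp_add (hf : T.FlatOn θ U f) (v : ℝ × ℝ) :
    T.FlatOn θ ((fun z => z + v) ⁻¹' U) (fun z => f (z + v)) := by
  refine ⟨hf.1.comp (by fun_prop) (mapsTo_preimage _ _), fun x hx e he hxe => ?_⟩
  obtain ⟨c, hc⟩ := hf.2 (x + v) hx e he hxe
  refine ⟨dev θ v + c, ?_⟩
  have : Tendsto (fun z : ℝ × ℝ => z + v) (𝓝 x) (𝓝 (x + v)) := by
    apply Continuous.tendsto; fun_prop
  filter_upwards [this.eventually hc] with z hz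
  rw [hz, dev_add]; ring

theorem continuousAt (hU : IsOpen U) (hf : T.FlatOn θ U f) {x : ℝ × ℝ} (hx : x ∈ U) :
    ContinuousAt f x := hf.1.continuousAt (hU.mem_nhds hx)

theorem exists_chart (hU : IsOpen U) (hf : T.FlatOn θ U f) {x : ℝ × ℝ} (hx : x ∈ U) :
    ∃ e ∈ T.atlas, f x ∈ e.source ∧ ∃ c : ℂ,
      ∀ᶠ z in 𝓝 x, f z ∈ e.source ∧ e (f z) = dev θ z + c := by
  obtain ⟨e, he, hxe⟩ := T.cover (f x)
  obtain ⟨c, hc⟩ := hf.2 x hx e he hxe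
  refine ⟨e, he, hxe, c, ?_⟩
  filter_upwards [hc, (hf.continuousAt hU hx) (e.open_source.mem_nhds hxe)] with z h1 h2
  exact ⟨h2, h1⟩

/-- In a chart `f` is `dev θ` plus a constant, and `dev θ` is a homeomorphism for `θ ≠ 0`. So flat
maps are local homeomorphisms. -/
theorem map_nhds (hθ : θ ≠ 0) (hU : IsOpen U) (hf : T.FlatOn θ U f) {x : ℝ × ℝ} (hx : x ∈ U) :
    map f (𝓝 x) = 𝓝 (f x) := by
  obtain ⟨e, he, hxe, c, hc⟩ := hf.exists_chart hU hx
  have h1 : f =ᶠ[𝓝 x] e.symm ∘ (fun z => dev θ z + c) := by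
    filter_upwards [hc] with z hz
    simp only [Function.comp]
    rw [← hz.2, e.left_inv hz.1]
  have h2 : map (fun z => dev θ z + c) (𝓝 x) = 𝓝 (dev θ x + c) := by
    have := ((devHomeo θ hθ).trans (Homeomorph.addRight c)).map_nhds_eq x
    rwa [show ⇑((devHomeo θ hθ).trans (Homeomorph.addRight c)) = fun z => dev θ z + c by
      ext z; simp [devHomeo_apply]] at this
  rw [Filter.map_congr h1, ← Filter.map_map, h2, ← hc.self_of_nhds.2,
    e.symm.map_nhds_eq (by simpa using e.map_source hxe)]
  simp [e.left_inv hxe]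

theorem image_mem_nhds (hθ : θ ≠ 0) (hU : IsOpen U) (hf : T.FlatOn θ U f) {x : ℝ × ℝ}
    (hx : x ∈ U) {W : Set (ℝ × ℝ)} (hW : W ∈ 𝓝 x) : f '' W ∈ 𝓝 (f x) := by
  rw [← hf.map_nhds hθ hU hx]; exact Filter.image_mem_map hW

theorem isOpen_image (hθ : θ ≠ 0) (hU : IsOpen U) (hf : T.FlatOn θ U f) : IsOpen (f '' U) := by
  rw [isOpen_iff_mem_nhds]
  rintro _ ⟨x, hx, rfl⟩
  exact hf.image_mem_nhds hθ hU hx (hU.mem_nhds hx)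

theorem exists_injOn (hθ : θ ≠ 0) (hU : IsOpen U) (hf : T.FlatOn θ U f) {x : ℝ × ℝ}
    (hx : x ∈ U) : ∃ W ∈ 𝓝 x, InjOn f W := by
  obtain ⟨e, he, hxe, c, hc⟩ := hf.exists_chart hU hx
  refine ⟨_, hc, fun z hz w hw h => dev_injective hθ ?_⟩
  have h1 : e (f z) = e (f w) := by rw [h]
  rw [hz.2, hw.2] at h1
  exact add_right_cancel h1

/-- Two flat maps which agree at a point of a preconnected open set agree on it. -/
theorem eqOn [T2Space Y] (hU : IsOpen U) (hc : IsPreconnected U)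
    (hf : T.FlatOn θ U f) (hg : T.FlatOn θ U g) {x : ℝ × ℝ} (hx : x ∈ U) (h : f x = g x) :
    EqOn f g U := by
  have : PreconnectedSpace U := isPreconnected_iff_preconnectedSpace.1 hc
  have hcl : IsClopen {z : U | f z = g z} := by
    refine ⟨isClosed_eq hf.1.domRestrict hg.1.domRestrict, isOpen_iff_mem_nhds.2 fun z hz => ?_⟩
    obtain ⟨e, he, hxe, c, hc⟩ := hf.exists_chart hU z.2
    have hz' : f z = g z := hz
    obtain ⟨c', hc'⟩ := hg.2 z z.2 e he (hz' ▸ hxe)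
    -- Agreement at the single point `z` equates the two translation constants, hence the maps
    -- nearby.
    have hcc : c = c' := by
      have h1 := hc.self_of_nhds.2
      have h2 := hc'.self_of_nhds
      rw [hz', h2] at h1
      exact (add_left_cancel h1).symm
    have h3 : ∀ᶠ w in 𝓝 (z : ℝ × ℝ), f w = g w := by
      filter_upwards [hc, hc', (hg.continuousAt hU z.2)
        (e.open_source.mem_nhds (hz' ▸ hxe))] with w h1 h2 h3
      apply e.injOn h1.1 h3
      rw [h1.2, h2, hcc]
    exact (continuous_subtype_val.tendsto z).eventually h3
  have := hcl.eq_univ ⟨⟨x, hx⟩, h⟩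
  intro z hz
  have h' : (⟨z, hz⟩ : U) ∈ {z : U | f z = g z} := this ▸ mem_univ _
  exact h'

end FlatOn

theorem exists_flatOn_ball (T : TranslationStructure Y) (θ : ℂ) (y : Y) :
    ∃ r > 0, ∃ f : ℝ × ℝ → Y, T.FlatOn θ (Metric.ball 0 r) f ∧ f 0 = y := by
  obtain ⟨e, he, hy⟩ := T.cover y
  have h1 : ∀ᶠ z : ℝ × ℝ in 𝓝 0, dev θ z + e y ∈ e.target := by
    have : Continuous fun z => dev θ z + e y := (continuous_dev θ).add continuous_const
    refine (this.tendsto 0).eventually (e.open_target.mem_nhds ?_)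
    simpa using e.map_source hy
  obtain ⟨r, hr, hr'⟩ := Metric.eventually_nhds_iff_ball.1 h1
  refine ⟨r, hr, fun z => e.symm (dev θ z + e y), ⟨?_, ?_⟩, by simp [e.left_inv hy]⟩
  · exact e.continuousOn_symm.comp ((continuous_dev θ).add continuous_const).continuousOn hr'
  · intro x hx e' he' hxe
    obtain ⟨c, hc⟩ := T.compat e he e' he' _ ⟨e.map_target (hr' x hx), hxe⟩
    refine ⟨e y + c, ?_⟩
    have h2 : ContinuousAt (fun z => e.symm (dev θ z + e y)) x :=
      (e.continuousAt_symm (hr' x hx)).comp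
        (f := fun z => dev θ z + e y) ((continuous_dev θ).add continuous_const).continuousAt
    filter_upwards [h2.eventually hc, Metric.isOpen_ball.mem_nhds hx] with z hz hz'
    rw [hz, e.right_inv (hr' z hz')]; ring

/-! ### Horizontal strips and periodic strips -/

/-- The horizontal strip of heights between `a` and `b`. -/
def strip (a b : ℝ) : Set (ℝ × ℝ) := univ ×ˢ Ioo a b

theorem mem_strip {a b : ℝ} {z : ℝ × ℝ} : z ∈ strip a b ↔ a < z.2 ∧ z.2 < b := by
  simp [strip]

theorem isOpen_strip (a b : ℝ) : IsOpen (strip a b) := isOpen_univ.prod isOpen_Ioo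

theorem convex_strip (a b : ℝ) : Convex ℝ (strip a b) := convex_univ.prod (convex_Ioo a b)

theorem mem_ball_zero_prod {r : ℝ} {z : ℝ × ℝ} :
    z ∈ Metric.ball (0 : ℝ × ℝ) r ↔ |z.1| < r ∧ |z.2| < r := by
  simp [Prod.norm_def]

theorem mem_ball_prod {r : ℝ} {z w : ℝ × ℝ} :
    z ∈ Metric.ball w r ↔ |z.1 - w.1| < r ∧ |z.2 - w.2| < r := by
  simp [Prod.dist_eq, Real.dist_eq]

theorem Cylinder.flatOn (C : T.Cylinder θ) : T.FlatOn θ (strip 0 C.height) C.param :=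
  ⟨C.continuousOn, C.flat⟩

theorem Cylinder.isOpen_carrier (C : T.Cylinder θ) (hθ : θ ≠ 0) : IsOpen C.carrier :=
  C.flatOn.isOpen_image hθ (isOpen_strip _ _)

theorem Cylinder.param_eq_iff (C : T.Cylinder θ) {x z : ℝ × ℝ} (hx : x ∈ strip 0 C.height)
    (hz : z ∈ strip 0 C.height) :
    C.param x = C.param z ↔ x.2 = z.2 ∧ ∃ n : ℤ, x.1 = z.1 + n * C.width :=
  C.eq_iff x hx z hz

theorem Cylinder.param_mem (C : T.Cylinder θ) {z : ℝ × ℝ} (hz : z ∈ strip 0 C.height) :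
    C.param z ∈ C.carrier := ⟨z, hz, rfl⟩

/-- The map and its translate by `v` are both flat on the intersection of the strip with a translate
of it. That set is convex, so one coincidence propagates to all of it. -/
theorem FlatOn.strip_shift [T2Space Y] {a b : ℝ} {f : ℝ × ℝ → Y} (hf : T.FlatOn θ (strip a b) f)
    {z v : ℝ × ℝ} (hz : z ∈ strip a b) (hzv : z + v ∈ strip a b) (h : f (z + v) = f z)
    {x : ℝ × ℝ} (hx : x ∈ strip a b) (hxv : x + v ∈ strip a b) : f (x + v) = f x := by
  have hU : IsOpen (strip a b ∩ (fun z => z + v) ⁻¹' strip a b) :=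
    (isOpen_strip a b).inter ((isOpen_strip a b).preimage (by fun_prop))
  have hc : Convex ℝ (strip a b ∩ (fun z => z + v) ⁻¹' strip a b) :=
    (convex_strip a b).inter ((convex_strip a b).translate_preimage_left v)
  exact FlatOn.eqOn hU hc.isPreconnected ((hf.comp_add v).mono inter_subset_right)
    (hf.mono inter_subset_left) ⟨hz, hzv⟩ h ⟨hx, hxv⟩

theorem exists_sub_mul_mem_Icc {w : ℝ} (hw : 0 < w) (x : ℝ) : ∃ n : ℤ, x + n * w ∈ Icc 0 w := by
  refine ⟨-⌊x / w⌋, ?_⟩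
  have h1 := Int.floor_le (x / w)
  have h2 := (Int.lt_floor_add_one (x / w)).le
  rw [le_div_iff₀ hw] at h1
  rw [div_le_iff₀ hw] at h2
  push_cast
  constructor <;> linarith

theorem FlatOn.strip_period [T2Space Y] {a b : ℝ} {f : ℝ × ℝ → Y}
    (hf : T.FlatOn θ (strip a b) f) {w : ℝ} {z₀ : ℝ × ℝ} (hz₀ : z₀ ∈ strip a b)
    (h : f (z₀ + (w, 0)) = f z₀) (n : ℤ) {z : ℝ × ℝ} (hz : z ∈ strip a b) :
    f (z + (n * w, 0)) = f z := by
  have key : ∀ x ∈ strip a b, f (x + (w, 0)) = f x := fun x hx =>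
    hf.strip_shift hz₀ (by simpa [mem_strip] using hz₀) h hx (by simpa [mem_strip] using hx)
  induction n using Int.induction_on with
  | zero => simp [show ((0 : ℝ), (0 : ℝ)) = 0 from rfl]
  | succ n ih =>
    rw [← ih, ← key (z + (((n : ℤ) : ℝ) * w, 0)) (by simpa [mem_strip] using hz)]
    congr 1
    ext <;> simp; ring
  | pred n ih =>
    rw [← ih, ← key (z + (((-(n : ℤ) - 1 : ℤ) : ℝ) * w, 0)) (by simpa [mem_strip] using hz)]
    congr 1
    ext <;> simp; ring

/-- A horizontally periodic flat strip in a connected non-compact surface does not return to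
itself at another height. -/
theorem FlatOn.strip_height_eq [T2Space Y] [PreconnectedSpace Y] [NoncompactSpace Y]
    (hθ : θ ≠ 0) {a b : ℝ} {f : ℝ × ℝ → Y} (hf : T.FlatOn θ (strip a b) f) {w : ℝ} (hw : 0 < w)
    {z₀ : ℝ × ℝ} (hz₀ : z₀ ∈ strip a b) (h : f (z₀ + (w, 0)) = f z₀) {x z : ℝ × ℝ}
    (hx : x ∈ strip a b) (hz : z ∈ strip a b) (hxz : f x = f z) : x.2 = z.2 := by
  wlog hlt : x.2 < z.2 generalizing x z
  · rcases lt_trichotomy x.2 z.2 with h1 | h1 | h1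
    · exact this hx hz hxz h1
    · exact h1
    · exact (this hz hx hxz.symm h1).symm
  exfalso
  -- Translation by `v` identifies the two heights, so the closed band between them has as image a
  -- torus `K`: compact, and open as shown below, hence the whole surface.
  set v := z - x with hv
  have hzx : x + v = z := by rw [hv]; abel
  have hxv : x + v ∈ strip a b := hzx ▸ hz
  have key : ∀ y ∈ strip a b, y + v ∈ strip a b → f (y + v) = f y := fun y hy hyv =>
    hf.strip_shift hx hxv (by rw [hzx, hxz]) hy hyv
  rw [mem_strip] at hx hz
  have hv2 : v.2 = z.2 - x.2 := rfl
  set K : Set Y := f '' (Icc 0 w ×ˢ Icc x.2 z.2) with hK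
  have hKc : IsCompact K := by
    refine (isCompact_Icc.prod isCompact_Icc).image_of_continuousOn (hf.1.mono ?_)
    rintro ⟨s, t⟩ ⟨-, ht1, ht2⟩
    exact mem_strip.2 ⟨hx.1.trans_le ht1, lt_of_le_of_lt ht2 hz.2⟩
  have hred : ∀ y : ℝ × ℝ, y.2 ∈ Icc x.2 z.2 → f y ∈ K := by
    intro y hy
    obtain ⟨n, hn⟩ := exists_sub_mul_mem_Icc hw y.1
    refine ⟨y + (n * w, 0), ⟨hn, by simpa using hy⟩, ?_⟩
    exact hf.strip_period hz₀ h n (mem_strip.2 ⟨hx.1.trans_le hy.1, lt_of_le_of_lt hy.2 hz.2⟩)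
  -- With `ε` below the margins to the edges of the strip and below the return height, one
  -- translation by `v` or `-v` folds the enlarged open band back into the closed one.
  obtain ⟨ε, hε, hε1, hε2, hε3⟩ : ∃ ε > 0, a < x.2 - ε ∧ z.2 + ε < b ∧ ε < z.2 - x.2 := by
    refine ⟨min (min (x.2 - a) (b - z.2)) (z.2 - x.2) / 2, ?_, ?_, ?_, ?_⟩
    · have : 0 < min (min (x.2 - a) (b - z.2)) (z.2 - x.2) := by
        simp only [lt_min_iff]; refine ⟨⟨?_, ?_⟩, ?_⟩ <;> linarith
      linarith
    all_goals
      have h1 := min_le_left (min (x.2 - a) (b - z.2)) (z.2 - x.2)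
      have h2 := min_le_right (min (x.2 - a) (b - z.2)) (z.2 - x.2)
      have h3 := min_le_left (x.2 - a) (b - z.2)
      have h4 := min_le_right (x.2 - a) (b - z.2)
      linarith
  have hsub : strip (x.2 - ε) (z.2 + ε) ⊆ strip a b := by
    intro y hy
    rw [mem_strip] at hy ⊢
    constructor <;> linarith
  have hKeq : K = f '' strip (x.2 - ε) (z.2 + ε) := by
    apply Subset.antisymm
    · apply image_mono
      rintro ⟨s, t⟩ ⟨-, ht1, ht2⟩
      exact mem_strip.2 ⟨by simp at ht1 ⊢; linarith, by simp at ht2 ⊢; linarith⟩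
    · rintro _ ⟨y, hy, rfl⟩
      have hy' := hsub hy
      rw [mem_strip] at hy hy'
      rcases lt_or_ge y.2 x.2 with h1 | h1
      · rw [← key y (hsub (mem_strip.2 hy))
          (mem_strip.2 ⟨by simp [hv2]; linarith, by simp [hv2]; linarith⟩)]
        exact hred _ ⟨by simp [hv2]; linarith, by simp [hv2]; linarith⟩
      · rcases le_or_gt y.2 z.2 with h2 | h2
        · exact hred _ ⟨h1, h2⟩
        · have h3 : y - v ∈ strip a b :=
            mem_strip.2 ⟨by simp [hv2]; linarith, by simp [hv2]; linarith⟩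
          have h4 : y - v + v = y := by abel
          have := key (y - v) h3 (by rw [h4]; exact mem_strip.2 hy')
          rw [h4] at this
          rw [this]
          exact hred _ ⟨by simp [hv2]; linarith, by simp [hv2]; linarith⟩
  have hopen : IsOpen K := by
    rw [hKeq]; exact (hf.mono hsub).isOpen_image hθ (isOpen_strip _ _)
  have huniv := IsClopen.eq_univ ⟨hKc.isClosed, hopen⟩ ⟨f x, hred x ⟨le_rfl, hlt.le⟩⟩
  exact noncompact_univ Y (huniv ▸ hKc)

/-- A horizontally periodic flat strip in a connected non-compact surface is a cylinder. -/
theorem FlatOn.strip_eq_iff [T2Space Y] [PreconnectedSpace Y] [NoncompactSpace Y]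
    (hθ : θ ≠ 0) {a b : ℝ} {f : ℝ × ℝ → Y} (hf : T.FlatOn θ (strip a b) f) {w : ℝ} (hw : 0 < w)
    {z₀ : ℝ × ℝ} (hz₀ : z₀ ∈ strip a b) (h : f (z₀ + (w, 0)) = f z₀) :
    ∃ w' > 0, (∃ n : ℤ, w = n * w') ∧ ∀ x ∈ strip a b, ∀ z ∈ strip a b,
      (f x = f z ↔ x.2 = z.2 ∧ ∃ n : ℤ, x.1 = z.1 + n * w') := by
  have hmem : ∀ {z : ℝ × ℝ} (c : ℝ), z ∈ strip a b → z + (c, 0) ∈ strip a b := by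
    intro z c hz
    simpa [mem_strip] using hz
  let G : AddSubgroup ℝ :=
    { carrier := {c | f (z₀ + (c, 0)) = f z₀}
      zero_mem' := by simp [show ((0 : ℝ), (0 : ℝ)) = 0 from rfl]
      add_mem' := by
        intro c d hc hd
        have := hf.strip_shift hz₀ (hmem d hz₀) hd (hmem c hz₀) (hmem d (hmem c hz₀))
        simp only [mem_ofPred_eq] at hc hd ⊢
        rw [← hc, ← this, add_assoc]
        simp
      neg_mem' := by
        intro c hc
        have := hf.strip_shift hz₀ (hmem c hz₀) hc (hmem (-c) hz₀) (hmem c (hmem (-c) hz₀))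
        simp only [mem_ofPred_eq] at hc ⊢
        rw [← this, add_assoc]
        simp [show ((0 : ℝ), (0 : ℝ)) = 0 from rfl] }
  have hG : ∀ c, c ∈ G ↔ f (z₀ + (c, 0)) = f z₀ := fun c => Iff.rfl
  -- Local injectivity isolates zero in the group `G` of horizontal periods, so `G` is cyclic; it
  -- contains `w ≠ 0`, and its positive generator is the true width.
  obtain ⟨W, hW, hinj⟩ := hf.exists_injOn hθ (isOpen_strip a b) hz₀
  obtain ⟨ε, hε, hεW⟩ := Metric.mem_nhds_iff.1 hW
  have hdisj : Disjoint (G : Set ℝ) (Ioo 0 ε) := by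
    rw [Set.disjoint_left]
    rintro c hc ⟨hc0, hcε⟩
    have h1 : z₀ + (c, 0) = z₀ := by
      refine hinj (hεW ?_) (mem_of_mem_nhds hW) ((hG c).1 hc)
      rw [mem_ball_prod]
      simp [abs_of_pos hc0, hcε, hε]
    have := congrArg Prod.fst h1
    simp at this
    exact hc0.ne' this
  obtain ⟨g, hg⟩ := AddSubgroup.cyclic_of_isolated_zero hε hdisj
  have hwG : w ∈ G := (hG w).2 h
  have hGz : ∀ c, c ∈ G ↔ ∃ n : ℤ, c = n * |g| := by
    intro c
    rw [hg, AddSubgroup.mem_closure_singleton]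
    constructor
    · rintro ⟨n, rfl⟩
      rcases abs_choice g with h1 | h1 <;> rw [h1]
      · exact ⟨n, by simp⟩
      · exact ⟨-n, by simp⟩
    · rintro ⟨n, rfl⟩
      rcases abs_choice g with h1 | h1 <;> rw [h1]
      · exact ⟨n, by simp⟩
      · exact ⟨-n, by simp⟩
  have hg0 : 0 < |g| := by
    rw [abs_pos]
    rintro rfl
    obtain ⟨n, hn⟩ := (hGz w).1 hwG
    simp at hn
    exact hw.ne' hn
  refine ⟨|g|, hg0, (hGz w).1 hwG, fun x hx z hz => ?_⟩
  constructor
  · intro hxz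
    have h2 := hf.strip_height_eq hθ hw hz₀ h hx hz hxz
    refine ⟨h2, ?_⟩
    have h3 : z + (x.1 - z.1, 0) = x := by ext <;> simp [h2]
    have h4 := hf.strip_shift hz (hmem _ hz) (by rw [h3]; exact hxz) hz₀ (hmem _ hz₀)
    obtain ⟨n, hn⟩ := (hGz _).1 ((hG _).2 h4)
    exact ⟨n, by linarith⟩
  · rintro ⟨h2, n, hn⟩
    have h3 : z + (n * |g|, 0) = x := by ext <;> simp [h2, hn]
    have h4 := (hG _).1 ((hGz _).2 ⟨n, rfl⟩)
    rw [← h3]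
    exact hf.strip_shift hz₀ (hmem _ hz₀) h4 hz (hmem _ hz)

/-- The cylinder filled by a horizontally periodic flat strip. -/
theorem FlatOn.exists_cylinder [T2Space Y] [PreconnectedSpace Y] [NoncompactSpace Y]
    (hθ : θ ≠ 0) {a b : ℝ} {f : ℝ × ℝ → Y} (hf : T.FlatOn θ (strip a b) f) {w : ℝ} (hw : 0 < w)
    {z₀ : ℝ × ℝ} (hz₀ : z₀ ∈ strip a b) (h : f (z₀ + (w, 0)) = f z₀) :
    ∃ C : T.Cylinder θ, C.height = b - a ∧ (∃ n : ℤ, w = n * C.width) ∧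
      (C.param = fun z => f (z + (0, a))) ∧ C.carrier = f '' strip a b := by
  obtain ⟨w', hw', hn, hiff⟩ := hf.strip_eq_iff hθ hw hz₀ h
  have hmem : ∀ z : ℝ × ℝ, z ∈ strip 0 (b - a) ↔ z + (0, a) ∈ strip a b := by
    intro z
    simp only [mem_strip, Prod.snd_add]
    constructor <;> rintro ⟨h1, h2⟩ <;> constructor <;> linarith
  have hpre : (fun z : ℝ × ℝ => z + (0, a)) ⁻¹' strip a b = strip 0 (b - a) := by
    ext z; exact (hmem z).symm
  have hfl := hf.comp_add (0, a)
  rw [hpre] at hfl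
  have hab : a < b := (mem_strip.1 hz₀).1.trans (mem_strip.1 hz₀).2
  refine ⟨⟨w', b - a, hw', sub_pos.2 hab, fun z => f (z + (0, a)), hfl.1, hfl.2, ?_⟩,
    rfl, hn, rfl, ?_⟩
  · intro x hx z hz
    rw [hiff _ ((hmem x).1 hx) _ ((hmem z).1 hz)]
    simp
  · apply Subset.antisymm
    · rintro _ ⟨z, hz, rfl⟩
      exact ⟨_, (hmem z).1 hz, rfl⟩
    · rintro _ ⟨z, hz, rfl⟩
      refine ⟨z + (0, -a), (hmem _).2 ?_, ?_⟩
      · simpa [add_assoc, show ((0 : ℝ), (0 : ℝ)) = 0 from rfl] using hz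
      · simp [add_assoc, show ((0 : ℝ), (0 : ℝ)) = 0 from rfl]

/-! ### Cylinders that meet, and maximal cylinders -/

namespace Cylinder

variable {C C' : T.Cylinder θ} {z z' : ℝ × ℝ}

/-- The parametrizations of two cylinders that meet differ by a translation. -/
theorem param_eq_param [T2Space Y] (hz : z ∈ strip 0 C.height) (hz' : z' ∈ strip 0 C'.height)
    (h : C.param z = C'.param z') {x : ℝ × ℝ} (hx : x ∈ strip 0 C.height)
    (hx' : x + (z' - z) ∈ strip 0 C'.height) : C.param x = C'.param (x + (z' - z)) := by
  have hU : IsOpen (strip 0 C.height ∩ (fun x => x + (z' - z)) ⁻¹' strip 0 C'.height) :=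
    (isOpen_strip _ _).inter ((isOpen_strip _ _).preimage (by fun_prop))
  have hc : Convex ℝ (strip 0 C.height ∩ (fun x => x + (z' - z)) ⁻¹' strip 0 C'.height) :=
    (convex_strip _ _).inter ((convex_strip _ _).translate_preimage_left _)
  exact FlatOn.eqOn hU hc.isPreconnected (C.flatOn.mono inter_subset_left)
    ((C'.flatOn.comp_add (z' - z)).mono inter_subset_right) (x := z)
    ⟨hz, by simpa using hz'⟩ (by simpa using h) ⟨hx, hx'⟩

/-- Moving horizontally by `C'.width` stays inside both strips, where the parametrizations differ by
a fixed translation. Thus a period of `C'` is a period of `C`. -/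
theorem exists_width_eq_mul [T2Space Y] (hz : z ∈ strip 0 C.height)
    (hz' : z' ∈ strip 0 C'.height) (h : C.param z = C'.param z') :
    ∃ n : ℤ, C'.width = n * C.width := by
  have h1 : z + (C'.width, 0) ∈ strip 0 C.height := by simpa [mem_strip] using hz
  have h3 : z + (C'.width, 0) + (z' - z) = z' + (C'.width, 0) := by abel
  have h4 : z' + (C'.width, 0) ∈ strip 0 C'.height := by simpa [mem_strip] using hz'
  have h2 := param_eq_param hz hz' h h1 (by rw [h3]; exact h4)
  have h5 : C'.param (z' + (C'.width, 0)) = C'.param z' := by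
    rw [C'.param_eq_iff h4 hz']
    exact ⟨by simp, 1, by simp⟩
  rw [h3, h5, ← h, C.param_eq_iff h1 hz] at h2
  obtain ⟨-, n, hn⟩ := h2
  exact ⟨n, by simpa using hn⟩

theorem width_eq_of_param_eq [T2Space Y] (hz : z ∈ strip 0 C.height)
    (hz' : z' ∈ strip 0 C'.height) (h : C.param z = C'.param z') : C.width = C'.width := by
  obtain ⟨n, hn⟩ := exists_width_eq_mul hz hz' h
  obtain ⟨m, hm⟩ := exists_width_eq_mul hz' hz h.symm
  have h1 := C.width_pos
  have h2 := C'.width_pos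
  have hnp : (0 : ℝ) < n := by by_contra hc; nlinarith
  have hmp : (0 : ℝ) < m := by by_contra hc; nlinarith
  have hn1 : (1 : ℝ) ≤ n := by exact_mod_cast (by exact_mod_cast hnp : (0 : ℤ) < n)
  have hm1 : (1 : ℝ) ≤ m := by exact_mod_cast (by exact_mod_cast hmp : (0 : ℤ) < m)
  apply le_antisymm <;> nlinarith

/-- Two cylinders that meet lie in a common cylinder. -/
theorem exists_union [T2Space Y] [PreconnectedSpace Y] [NoncompactSpace Y] (hθ : θ ≠ 0)
    (hz : z ∈ strip 0 C.height) (hz' : z' ∈ strip 0 C'.height) (h : C.param z = C'.param z') :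
    ∃ D : T.Cylinder θ, ∃ a b : ℝ, a ≤ 0 ∧ C.height ≤ b ∧ a ≤ z.2 - z'.2 ∧
      C'.height + (z.2 - z'.2) ≤ b ∧ D.height = b - a ∧
      D.carrier = C.carrier ∪ C'.carrier ∧
      (∀ x ∈ strip 0 C.height, D.param (x - (0, a)) = C.param x) := by
  classical
  set v := z' - z with hv
  have hv2 : v.2 = z'.2 - z.2 := rfl
  -- In the coordinates of `C`, the cylinder `C'` fills the heights from `-v.2` to `C'.height -
  -- v.2`. Both intervals contain `z.2`, so their union is the interval from `a` to `b`.
  set a := min 0 (-v.2) with ha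
  set b := max C.height (C'.height - v.2) with hb
  set V := (fun x => x + v) ⁻¹' strip 0 C'.height with hV
  let G : ℝ × ℝ → Y := fun x => if x ∈ strip 0 C.height then C.param x else C'.param (x + v)
  have hG1 : EqOn G C.param (strip 0 C.height) := fun x hx => if_pos hx
  have hG2 : EqOn G (fun x => C'.param (x + v)) V := by
    intro x hx
    by_cases hxs : x ∈ strip 0 C.height
    · rw [hG1 hxs]; exact param_eq_param hz hz' h hxs hx
    · exact if_neg hxs
  have hz1 := mem_strip.1 hz
  have hz2 := mem_strip.1 hz'
  have hcov : strip a b = strip 0 C.height ∪ V := by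
    ext x
    simp only [hV, mem_union, mem_preimage, mem_strip, ha, hb, min_lt_iff, lt_max_iff,
      Prod.snd_add]
    constructor
    · rintro ⟨h1, h2⟩
      by_cases hx : 0 < x.2 ∧ x.2 < C.height
      · exact Or.inl hx
      · right
        rw [not_and_or] at hx
        rcases hx with hx | hx <;> rcases h1 with h1 | h1 <;> rcases h2 with h2 | h2 <;>
          constructor <;> linarith
    · rintro (⟨h1, h2⟩ | ⟨h1, h2⟩)
      · exact ⟨Or.inl h1, Or.inl h2⟩
      · exact ⟨Or.inr (by linarith), Or.inr (by linarith)⟩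
  have hVo : IsOpen V := (isOpen_strip _ _).preimage (by fun_prop)
  have hGf : T.FlatOn θ (strip a b) G := by
    apply FlatOn.of_locally
    intro x hx
    rw [hcov] at hx
    rcases hx with hx | hx
    · exact ⟨_, C.param, isOpen_strip _ _, hx, C.flatOn, hG1⟩
    · exact ⟨V, _, hVo, hx, C'.flatOn.comp_add v, hG2⟩
  have hzab : z ∈ strip a b := by rw [hcov]; exact Or.inl hz
  have hzw : z + (C.width, 0) ∈ strip 0 C.height := by simpa [mem_strip] using hz
  have hper : G (z + (C.width, 0)) = G z := by
    rw [hG1 hz, hG1 hzw, C.param_eq_iff hzw hz]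
    exact ⟨by simp, 1, by simp⟩
  obtain ⟨D, hDh, -, hDp, hDc⟩ := hGf.exists_cylinder hθ C.width_pos hzab hper
  refine ⟨D, a, b, min_le_left _ _, le_max_left _ _, ?_, ?_, hDh, ?_, ?_⟩
  · exact (min_le_right _ _).trans (by rw [hv2]; linarith)
  · exact le_trans (by rw [hv2]; linarith) (le_max_right _ _)
  · rw [hDc, hcov, image_union, hG1.image_eq, hG2.image_eq]
    congr 1
    rw [hV, ← image_image (g := C'.param) (f := fun x => x + v),
      image_preimage_eq _ (add_right_surjective v)]
    rfl
  · intro x hx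
    rw [hDp]
    simp only [sub_add_cancel]
    exact hG1 hx

/-- Here the union cylinder `D` has the same carrier as `C`. A cylinder never repeats a height, so
`D` has no room beyond `C`: `a = 0` and `b = C.height`, and `C'` fits between them. -/
theorem height_le_of_carrier_subset [T2Space Y] [PreconnectedSpace Y] [NoncompactSpace Y]
    (hθ : θ ≠ 0) (hz : z ∈ strip 0 C.height) (hz' : z' ∈ strip 0 C'.height)
    (h : C.param z = C'.param z') (hsub : C'.carrier ⊆ C.carrier) :
    z'.2 ≤ z.2 ∧ C'.height - z'.2 ≤ C.height - z.2 := by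
  obtain ⟨D, a, b, ha, hb, ha', hb', hh, hc, hp⟩ := exists_union hθ hz hz' h
  rw [union_eq_left.2 hsub] at hc
  have hC := C.height_pos
  have key : ∀ t, a < t → t < b → 0 < t ∧ t < C.height := by
    intro t h1 h2
    have hm : ((0 : ℝ), t - a) ∈ strip 0 D.height :=
      mem_strip.2 ⟨by simpa using h1, by simpa [hh] using h2⟩
    have h3 : D.param (0, t - a) ∈ C.carrier := hc ▸ D.param_mem hm
    obtain ⟨x, hx, hxt⟩ := h3
    rw [← hp x hx, D.param_eq_iff _ hm] at hxt
    · have h4 := hxt.1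
      simp at h4
      have := mem_strip.1 hx
      rwa [h4] at this
    · have := mem_strip.1 hx
      exact mem_strip.2 ⟨by simp; linarith, by simp [hh]; linarith⟩
  have ha0 : a = 0 := by
    by_contra hne
    have hlt : a < 0 := lt_of_le_of_ne ha hne
    have := (key (a / 2) (by linarith) (by linarith)).1
    linarith
  have hbh : b = C.height := by
    by_contra hne
    have hlt : C.height < b := lt_of_le_of_ne hb (Ne.symm hne)
    have := (key ((C.height + b) / 2) (by linarith) (by linarith)).2
    linarith
  constructor <;> linarith

theorem IsMaximal.subset_of_meet [T2Space Y] [PreconnectedSpace Y] [NoncompactSpace Y]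
    (hθ : θ ≠ 0) (hC : C.IsMaximal) (h : (C.carrier ∩ C'.carrier).Nonempty) :
    C'.carrier ⊆ C.carrier := by
  obtain ⟨_, ⟨z, hz, rfl⟩, ⟨z', hz', h'⟩⟩ := h
  obtain ⟨D, a, b, -, -, -, -, -, hc, -⟩ := exists_union hθ hz hz' h'.symm
  rw [← hC D (hc ▸ subset_union_left), hc]
  exact subset_union_right

/-- Two maximal cylinders that meet differ only by a horizontal translation. -/
theorem IsMaximal.eq_of_param_eq [T2Space Y] [PreconnectedSpace Y] [NoncompactSpace Y]
    (hθ : θ ≠ 0) (hC : C.IsMaximal) (hC' : C'.IsMaximal) (hz : z ∈ strip 0 C.height)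
    (hz' : z' ∈ strip 0 C'.height) (h : C.param z = C'.param z') :
    C.width = C'.width ∧ C.height = C'.height ∧ z.2 = z'.2 ∧ C.carrier = C'.carrier ∧
      ∀ x ∈ strip 0 C.height, C.param x = C'.param (x + (z'.1 - z.1, 0)) := by
  have h1 : C'.carrier ⊆ C.carrier :=
    hC.subset_of_meet hθ ⟨_, C.param_mem hz, h ▸ C'.param_mem hz'⟩
  have h2 : C.carrier ⊆ C'.carrier :=
    hC'.subset_of_meet hθ ⟨_, C'.param_mem hz', h ▸ C.param_mem hz⟩
  have h3 := height_le_of_carrier_subset hθ hz hz' h h1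
  have h4 := height_le_of_carrier_subset hθ hz' hz h.symm h2
  have h5 : z.2 = z'.2 := le_antisymm h4.1 h3.1
  have h6 : C.height = C'.height := by linarith [h3.2, h4.2]
  refine ⟨width_eq_of_param_eq hz hz' h, h6, h5, h2.antisymm h1, fun x hx => ?_⟩
  have h7 : z' - z = (z'.1 - z.1, 0) := by ext <;> simp [h5]
  rw [← h7]
  refine param_eq_param hz hz' h hx ?_
  rw [h7, ← h6]
  simpa [mem_strip] using hx

end Cylinder

/-! ### Flat maps and coverings -/

variable {E : Type*} [TopologicalSpace E] {q : E → Y} {U : Set (ℝ × ℝ)}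

theorem FlatOn.proj {hq : IsLocalHomeomorph q} {f : ℝ × ℝ → E} (hU : IsOpen U)
    (hf : (T.pullback q hq).FlatOn θ U f) : T.FlatOn θ U (q ∘ f) := by
  refine ⟨hq.continuous.comp_continuousOn hf.1, fun x hx e he hxe => ?_⟩
  obtain ⟨a, ha, hxa, c, hc⟩ := hf.exists_chart hU hx
  obtain ⟨c', hc'⟩ := ha (f x) hxa e he hxe
  refine ⟨c - c', ?_⟩
  filter_upwards [hc, (hf.continuousAt hU hx).eventually hc'] with z hz hz'
  rw [hz.2] at hz'
  simp only [Function.comp]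
  linear_combination -hz'

theorem FlatOn.of_proj {hq : IsLocalHomeomorph q} {f : ℝ × ℝ → E} (hU : IsOpen U)
    (hc : ContinuousOn f U) (hf : T.FlatOn θ U (q ∘ f)) : (T.pullback q hq).FlatOn θ U f := by
  refine ⟨hc, fun x hx a ha hxa => ?_⟩
  obtain ⟨e, he, hxe⟩ := T.cover (q (f x))
  obtain ⟨c, hc1⟩ := hf.2 x hx e he hxe
  obtain ⟨c', hc'⟩ := ha (f x) hxa e he hxe
  refine ⟨c + c', ?_⟩
  filter_upwards [hc1, (hc.continuousAt (hU.mem_nhds hx)).eventually hc'] with z hz hz'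
  rw [hz', ← Function.comp_apply (f := q), hz]
  ring

/-- Flat maps on convex open sets lift to coverings. -/
theorem FlatOn.exists_lift (hcov : IsCoveringMap q) {f : ℝ × ℝ → Y} (hU : IsOpen U)
    (hc : Convex ℝ U) (hf : T.FlatOn θ U f) {z₀ : ℝ × ℝ} (hz₀ : z₀ ∈ U) {x₀ : E}
    (hx₀ : q x₀ = f z₀) :
    ∃ F : ℝ × ℝ → E, (T.pullback q hcov.isLocalHomeomorph).FlatOn θ U F ∧ F z₀ = x₀ ∧
      ∀ z ∈ U, q (F z) = f z := by
  classical
  have : ContractibleSpace U := hc.contractibleSpace ⟨z₀, hz₀⟩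
  have : LocallyPathConnectedSpace U := hU.locallyPathConnectedSpace
  obtain ⟨G, ⟨hG0, hG⟩, -⟩ := hcov.existsUnique_continuousMap_lifts
    ⟨U.domRestrict f, hf.1.domRestrict⟩ (⟨z₀, hz₀⟩ : U) x₀ hx₀
  let F : ℝ × ℝ → E := fun z => if hz : z ∈ U then G ⟨z, hz⟩ else x₀
  have hF : ∀ z (hz : z ∈ U), F z = G ⟨z, hz⟩ := fun z hz => dif_pos hz
  have hqF : ∀ z ∈ U, q (F z) = f z := fun z hz => by
    rw [hF z hz]; exact congrFun hG ⟨z, hz⟩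
  have hFc : ContinuousOn F U := by
    rw [continuousOn_iff_continuous_domRestrict]
    convert G.continuous using 1
    ext z
    exact hF z z.2
  refine ⟨F, FlatOn.of_proj hU hFc (FlatOn.congr_of_isOpen hU hf hqF), ?_, hqF⟩
  rw [hF z₀ hz₀, hG0]

end TranslationStructure

/-! ### Cylinders of the cover and of the base -/

namespace ZdCover

open TranslationStructure

variable {Y : Type*} [TopologicalSpace Y] {x₀ : Y} {d : ℕ}
  {ζ : FirstHomology Y x₀ →+ (Fin d → ℤ)} {E : Type*} [TopologicalSpace E]
  {T : TranslationStructure Y} {θ : ℂ}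

theorem deck_zero (P : ZdCover ζ E) (x : E) : P.deck 0 x = x :=
  (P.deck 0).injective (by rw [← P.deck_add]; simp)

theorem deck_neg_deck (P : ZdCover ζ E) (n : Fin d → ℤ) (x : E) : P.deck (-n) (P.deck n x) = x := by
  rw [← P.deck_add]; simp [P.deck_zero]

theorem proj_deck (P : ZdCover ζ E) (n : Fin d → ℤ) (x : E) : P.proj (P.deck n x) = P.proj x :=
  ((P.fibre x _).2 ⟨n, rfl⟩).symm

theorem pathConnectedSpace_base (P : ZdCover ζ E) : PathConnectedSpace Y := by
  have := P.pathConnected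
  exact P.surjective.pathConnectedSpace P.isCoveringMap.continuous

/-- Freeness of the deck action: the constant path at `x` ends both at `P.deck n x` and at `P.deck 0
x`, so the monodromy of one and the same loop is `n` and `0`. -/
theorem eq_zero_of_deck_eq (P : ZdCover ζ E) {n : Fin d → ℤ} {x : E} (h : P.deck n x = x) : n = 0 := by
  have := P.pathConnectedSpace_base
  obtain δ := PathConnectedSpace.somePath x₀ (P.proj x)
  have h1 := P.monodromy x n ((Path.refl x).cast rfl h) (Path.refl _) δ (fun t => rfl)
  have h2 := P.monodromy x 0 ((Path.refl x).cast rfl (P.deck_zero x)) (Path.refl _) δ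
    (fun t => rfl)
  rw [← h1, h2]

theorem t2Space (P : ZdCover ζ E) [T2Space Y] : T2Space E := by
  refine ⟨fun x y hxy => ?_⟩
  by_cases h : P.proj x = P.proj y
  · exact P.isCoveringMap.isSeparatedMap x y h hxy
  · obtain ⟨u, v, hu, hv, hxu, hyv, huv⟩ := t2_separation h
    exact ⟨_, _, hu.preimage P.isCoveringMap.continuous, hv.preimage P.isCoveringMap.continuous,
      hxu, hyv, huv.preimage _⟩

theorem noncompactSpace (P : ZdCover ζ E) [NoncompactSpace Y] : NoncompactSpace E := by
  rw [← not_compactSpace_iff]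
  intro h
  have := P.surjective.compactSpace P.isCoveringMap.continuous
  exact not_compactSpace_iff.2 ‹NoncompactSpace Y› this

theorem preconnectedSpace (P : ZdCover ζ E) : PreconnectedSpace E := by
  have := P.pathConnected
  infer_instance

theorem flatOn_deck (P : ZdCover ζ E) (n : Fin d → ℤ) {U : Set (ℝ × ℝ)} {f : ℝ × ℝ → E} (hU : IsOpen U)
    (hf : (P.flat T).FlatOn θ U f) : (P.flat T).FlatOn θ U (P.deck n ∘ f) := by
  refine FlatOn.of_proj hU ((P.deck n).continuous.comp_continuousOn hf.1) ?_
  rw [show P.proj ∘ P.deck n ∘ f = P.proj ∘ f from funext fun z => P.proj_deck n _]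
  exact hf.proj hU

/-- The image of a cylinder under a deck transformation. -/
def deckCylinder (P : ZdCover ζ E) (n : Fin d → ℤ) (C : (P.flat T).Cylinder θ) : (P.flat T).Cylinder θ where
  width := C.width
  height := C.height
  width_pos := C.width_pos
  height_pos := C.height_pos
  param := P.deck n ∘ C.param
  continuousOn := (P.flatOn_deck n (isOpen_strip _ _) C.flatOn).1
  flat := (P.flatOn_deck n (isOpen_strip _ _) C.flatOn).2
  eq_iff x hx z hz := by
    simp only [Function.comp, (P.deck n).injective.eq_iff]
    exact C.eq_iff x hx z hz

theorem carrier_deckCylinder (P : ZdCover ζ E) (n : Fin d → ℤ) (C : (P.flat T).Cylinder θ) :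
    (P.deckCylinder n C).carrier = P.deck n '' C.carrier := by
  exact image_comp (P.deck n) C.param _

theorem isMaximal_deckCylinder (P : ZdCover ζ E) (n : Fin d → ℤ) {C : (P.flat T).Cylinder θ} (hC : C.IsMaximal) :
    (P.deckCylinder n C).IsMaximal := by
  intro C' h
  rw [carrier_deckCylinder] at h ⊢
  have h1 : ∀ (n : Fin d → ℤ) (s : Set E), P.deck (-n) '' (P.deck n '' s) = s := by
    intro n s
    rw [image_image]
    simp [P.deck_neg_deck]
  have h2 := hC (P.deckCylinder (-n) C') (by
    rw [carrier_deckCylinder, ← h1 n C.carrier]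
    exact image_mono h)
  rw [carrier_deckCylinder] at h2
  rw [← h2]
  simpa using (h1 (-n) C'.carrier).symm

section

variable [T2Space Y] [NoncompactSpace Y]

/-- The projected strip is periodic, hence has some true width `w` with `C.width = n * w`.
Translation by `w` upstairs is a deck transformation `m`, and `n • m` fixes a point. Freeness and
the absence of torsion in `ℤ^d` give `m = 0`, so `w` is already a period upstairs. -/
theorem proj_param_eq_iff (P : ZdCover ζ E) (hθ : θ ≠ 0) (C : (P.flat T).Cylinder θ)
    {x z : ℝ × ℝ} (hx : x ∈ strip 0 C.height) (hz : z ∈ strip 0 C.height) :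
    P.proj (C.param x) = P.proj (C.param z) ↔ x.2 = z.2 ∧ ∃ n : ℤ, x.1 = z.1 + n * C.width := by
  have := P.t2Space
  have := P.pathConnectedSpace_base
  have hf : T.FlatOn θ (strip 0 C.height) (P.proj ∘ C.param) := C.flatOn.proj (isOpen_strip _ _)
  have hh := C.height_pos
  have hz0 : ((0 : ℝ), C.height / 2) ∈ strip 0 C.height :=
    mem_strip.2 ⟨by simp; linarith, by simp; linarith⟩
  have hmem : ∀ s : ℝ, ∀ x ∈ strip 0 C.height, x + (s, 0) ∈ strip 0 C.height :=
    fun s x hx => by simpa [mem_strip] using hx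
  set z₀ : ℝ × ℝ := (0, C.height / 2) with hz₀
  have hper : C.param (z₀ + (C.width, 0)) = C.param z₀ := by
    rw [C.param_eq_iff (hmem _ _ hz0) hz0]
    exact ⟨by simp, 1, by simp⟩
  obtain ⟨w, hw, ⟨n, hn⟩, hiff⟩ := hf.strip_eq_iff hθ C.width_pos hz0 (congrArg P.proj hper)
  suffices w = C.width by
    rw [← this]; exact hiff x hx z hz
  have h1 : P.proj (C.param z₀) = P.proj (C.param (z₀ + (w, 0))) :=
    ((hiff _ (hmem _ _ hz0) _ hz0).2 ⟨by simp, 1, by simp⟩).symm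
  obtain ⟨m, hm⟩ := (P.fibre _ _).1 h1
  -- Known at `z₀` only; both sides are flat, so equality spreads over the strip and can be
  -- iterated.
  have h2 : ∀ x ∈ strip 0 C.height, P.deck m (C.param x) = C.param (x + (w, 0)) := by
    have h3 := C.flatOn.comp_add (w, 0)
    refine FlatOn.eqOn (isOpen_strip _ _) (convex_strip _ _).isPreconnected
      (P.flatOn_deck m (isOpen_strip _ _) C.flatOn) (h3.mono fun x hx => hmem _ x hx) hz0 hm
  have h4 : ∀ k : ℕ, P.deck (k • m) (C.param z₀) = C.param (z₀ + (k * w, 0)) := by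
    intro k
    induction k with
    | zero => simp [P.deck_zero, show ((0 : ℝ), (0 : ℝ)) = 0 from rfl]
    | succ k ih =>
      rw [add_smul, one_smul, add_comm, P.deck_add, ih, h2 _ (hmem _ _ hz0)]
      congr 1
      ext <;> simp; ring
  have hn0 : 0 < n := by
    have := C.width_pos
    by_contra hc
    have : (n : ℝ) ≤ 0 := by exact_mod_cast not_lt.1 hc
    nlinarith
  have h5 := h4 n.toNat
  have h6 : ((n.toNat : ℕ) : ℝ) = n := by
    exact_mod_cast congrArg (Int.cast (R := ℝ)) (Int.toNat_of_nonneg hn0.le)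
  rw [h6, ← hn, hper] at h5
  have h7 := P.eq_zero_of_deck_eq h5
  have hm0 : m = 0 := by
    rcases smul_eq_zero.1 h7 with h | h
    · omega
    · exact h
  rw [hm0, P.deck_zero, eq_comm, C.param_eq_iff (hmem _ _ hz0) hz0] at hm
  obtain ⟨-, k, hk⟩ := hm
  have hk' : w = k * C.width := by simpa [hz₀] using hk
  have hW := C.width_pos
  have hk0 : (0 : ℝ) < k := by by_contra hc; nlinarith
  have hk1 : (1 : ℝ) ≤ k := by exact_mod_cast (by exact_mod_cast hk0 : (0 : ℤ) < k)
  have hn1 : (1 : ℝ) ≤ n := by exact_mod_cast hn0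
  apply le_antisymm <;> nlinarith

/-- The projection of a cylinder of the cover. -/
def projCylinder (P : ZdCover ζ E) (hθ : θ ≠ 0) (C : (P.flat T).Cylinder θ) : T.Cylinder θ where
  width := C.width
  height := C.height
  width_pos := C.width_pos
  height_pos := C.height_pos
  param := P.proj ∘ C.param
  continuousOn := (C.flatOn.proj (isOpen_strip _ _)).1
  flat := (C.flatOn.proj (isOpen_strip _ _)).2
  eq_iff _ hx _ hz := P.proj_param_eq_iff hθ C hx hz

theorem carrier_projCylinder (P : ZdCover ζ E) (hθ : θ ≠ 0) (C : (P.flat T).Cylinder θ) :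
    (P.projCylinder hθ C).carrier = P.proj '' C.carrier := by
  exact image_comp P.proj C.param _

/-- Every cylinder meeting the projection of a maximal cylinder of the cover lies inside it. -/
theorem subset_projCylinder (P : ZdCover ζ E) (hθ : θ ≠ 0) {C : (P.flat T).Cylinder θ} (hC : C.IsMaximal)
    {C' : T.Cylinder θ} (h : ((P.projCylinder hθ C).carrier ∩ C'.carrier).Nonempty) :
    C'.carrier ⊆ (P.projCylinder hθ C).carrier := by
  have := P.t2Space
  have := P.pathConnectedSpace_base
  have := P.noncompactSpace
  have := P.preconnectedSpace
  obtain ⟨_, ⟨z, hz, rfl⟩, ⟨z', hz', h'⟩⟩ := h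
  obtain ⟨D, a, b, ha, hb, -, -, hh, hc, hp⟩ := Cylinder.exists_union hθ hz hz' h'.symm
  have hfl := D.flatOn.comp_add (-(0, a))
  have hpre : (fun x : ℝ × ℝ => x + -(0, a)) ⁻¹' strip 0 D.height = strip a b := by
    ext x
    simp only [mem_preimage, mem_strip, hh, Prod.snd_add, Prod.snd_neg]
    constructor <;> rintro ⟨h1, h2⟩ <;> constructor <;> linarith
  rw [hpre] at hfl
  have hsub : strip 0 C.height ⊆ strip a b := by
    intro x hx
    have h1 := mem_strip.1 hx
    have h2 : C.height ≤ b := hb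
    exact mem_strip.2 ⟨by linarith, by linarith⟩
  have hpx : ∀ x ∈ strip 0 C.height, D.param (x + -(0, a)) = P.proj (C.param x) := by
    intro x hx
    rw [← sub_eq_add_neg]
    exact hp x hx
  obtain ⟨F, hF, hF0, hFp⟩ := hfl.exists_lift P.isCoveringMap (isOpen_strip a b)
    (convex_strip a b) (hsub hz) (x₀ := C.param z) (hpx z hz).symm
  change (P.flat T).FlatOn θ (strip a b) F at hF
  have hFC : EqOn F C.param (strip 0 C.height) :=
    FlatOn.eqOn (isOpen_strip _ _) (convex_strip _ _).isPreconnected (hF.mono hsub) C.flatOn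
      hz hF0
  have hzw : z + (C.width, 0) ∈ strip 0 C.height := by
    have : z ∈ strip 0 C.height := hz
    simpa [mem_strip] using this
  -- The lifted strip inherits the period of `C`, with which it agrees on the smaller strip. It is
  -- thus a cylinder containing `C`, and maximality of `C` leaves no new points.
  have hper : F (z + (C.width, 0)) = F z := by
    rw [hFC hzw, hFC hz, C.param_eq_iff hzw hz]
    exact ⟨by simp, 1, by simp⟩
  obtain ⟨C'', -, -, -, hcar⟩ := hF.exists_cylinder hθ C.width_pos (hsub hz) hper
  have h1 : C''.carrier = C.carrier := by
    apply hC
    rw [hcar]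
    exact hFC.image_eq.symm.subset.trans (image_mono hsub)
  have h2 : D.carrier = (P.projCylinder hθ C).carrier := by
    rw [carrier_projCylinder, ← h1, hcar, image_image]
    have h3 : D.carrier = (fun x => D.param (x + -(0, a))) '' strip a b := by
      rw [← hpre, ← image_image (g := D.param), image_preimage_eq _ (add_right_surjective _)]
      rfl
    rw [h3]
    exact image_congr fun x hx => (hFp x hx).symm
  rw [← h2, hc]
  exact subset_union_right

theorem isMaximal_projCylinder (P : ZdCover ζ E) (hθ : θ ≠ 0) {C : (P.flat T).Cylinder θ} (hC : C.IsMaximal) :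
    (P.projCylinder hθ C).IsMaximal := by
  intro C' h
  refine (P.subset_projCylinder hθ hC ?_).antisymm h
  rw [inter_eq_left.2 h]
  have := C.height_pos
  exact ⟨_, (P.projCylinder hθ C).param_mem (z := (0, C.height / 2))
    (mem_strip.2 ⟨by simp; linarith, by simp [projCylinder]; linarith⟩)⟩

/-- Over each point of a cylinder of the base lies a maximal cylinder of the cover. -/
theorem exists_maximal_meet (P : ZdCover ζ E) (hθ : θ ≠ 0) (hper : (P.flat T).IsPeriodic θ) (C : T.Cylinder θ) :
    ∃ C' : (P.flat T).Cylinder θ, C'.IsMaximal ∧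
      ((P.projCylinder hθ C').carrier ∩ C.carrier).Nonempty := by
  have := C.height_pos
  have hm : C.param (0, C.height / 2) ∈ C.carrier :=
    C.param_mem (mem_strip.2 ⟨by simp; linarith, by simp; linarith⟩)
  obtain ⟨x, hx⟩ := P.surjective (C.param (0, C.height / 2))
  obtain ⟨C', hC', hxC⟩ := hper.1 x
  have hopen : IsOpen (P.proj ⁻¹' C.carrier) :=
    (C.isOpen_carrier hθ).preimage P.isCoveringMap.continuous
  obtain ⟨y, hy1, hy2⟩ := mem_closure_iff.1 hxC _ hopen (by rw [mem_preimage, hx]; exact hm)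
  refine ⟨C', hC', P.proj y, ?_, hy1⟩
  rw [carrier_projCylinder]
  exact mem_image_of_mem _ hy2

theorem isPeriodic_base (P : ZdCover ζ E) (hθ : θ ≠ 0) (hper : (P.flat T).IsPeriodic θ) : T.IsPeriodic θ := by
  have := P.pathConnectedSpace_base
  constructor
  · intro y
    obtain ⟨x, rfl⟩ := P.surjective y
    obtain ⟨C, hC, hxC⟩ := hper.1 x
    refine ⟨P.projCylinder hθ C, P.isMaximal_projCylinder hθ hC, ?_⟩
    rw [carrier_projCylinder]
    exact image_closure_subset_closure_image P.isCoveringMap.continuous (mem_image_of_mem _ hxC)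
  -- Each maximal cylinder downstairs meets, hence equals up to a horizontal translation, the
  -- projection of a maximal one upstairs, so commensurability descends.
  · have key : ∀ C : T.Cylinder θ, C.IsMaximal → ∃ C' : (P.flat T).Cylinder θ, C'.IsMaximal ∧
        C.modulus = C'.modulus := by
      intro C hC
      obtain ⟨C', hC', y, ⟨z, hz, hzy⟩, ⟨z', hz', rfl⟩⟩ := P.exists_maximal_meet hθ hper C
      obtain ⟨h1, h2, -⟩ := (P.isMaximal_projCylinder hθ hC').eq_of_param_eq hθ hC hz hz' hzy
      refine ⟨C', hC', ?_⟩
      simp only [Cylinder.modulus, ← h1, ← h2]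
      rfl
    intro C D hC hD
    obtain ⟨C', hC', h1⟩ := key C hC
    obtain ⟨D', hD', h2⟩ := key D hD
    rw [h1, h2]
    exact hper.2 C' D' hC' hD'

end

end ZdCover

/-! ### Punctures and extension of homeomorphisms -/

/-- In a compact Hausdorff space, a filter on the complement of a finite set which has a basis of
preconnected sets and no cluster point there converges to a point of the finite set. -/
theorem exists_tendsto_of_not_clusterPt {X : Type*} [TopologicalSpace X] [CompactSpace X]
    [T2Space X] {s : Set X} (hs : s.Finite) (F : Filter {x : X // x ∉ s}) [NeBot F]
    (hb : ∀ U ∈ F, ∃ B ∈ F, B ⊆ U ∧ IsPreconnected B) (hcl : ∀ y, ¬ ClusterPt y F) :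
    ∃ p ∈ s, Tendsto Subtype.val F (𝓝 p) := by
  classical
  -- Off open neighbourhoods of `s` the space is compact and misses `s`; if `F` did not concentrate
  -- near `s` it would have a cluster point there.
  have step : ∀ W : X → Set X, (∀ p ∈ s, IsOpen (W p) ∧ p ∈ W p) →
      (Subtype.val ⁻¹' (⋃ p ∈ s, W p) : Set {x : X // x ∉ s}) ∈ F := by
    intro W hW
    by_contra hn
    have hK : IsCompact (⋃ p ∈ s, W p)ᶜ :=
      (isOpen_biUnion fun p hp => (hW p hp).1).isClosed_compl.isCompact
    have hK' : IsCompact (Subtype.val ⁻¹' (⋃ p ∈ s, W p) : Set {x : X // x ∉ s})ᶜ := by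
      rw [IsEmbedding.subtypeVal.isCompact_iff, ← preimage_compl,
        image_preimage_eq_inter_range, Subtype.range_coe_subtype]
      rwa [inter_eq_left.2]
      intro x hx hxs
      exact hx (mem_biUnion hxs (hW x hxs).2)
    have := notMem_iff_inf_principal_compl.1 hn
    obtain ⟨y, -, hy⟩ := hK' (f := F ⊓ 𝓟 _) inf_le_right
    exact hcl y (hy.mono inf_le_left)
  obtain ⟨V, hV, hdisj⟩ := hs.t2_separation
  -- A preconnected member of `F` inside disjoint neighbourhoods lies in just one of them. This
  -- selects `p`.
  obtain ⟨B, hBF, hBV, hB⟩ := hb _ (step V fun p _ => ⟨(hV p).2, (hV p).1⟩)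
  obtain ⟨b, hbB⟩ := Filter.nonempty_of_mem hBF
  obtain ⟨p, hp, hbp⟩ := mem_iUnion₂.1 (hBV hbB)
  have hBp : B ⊆ Subtype.val ⁻¹' V p := by
    refine hB.subset_left_of_subset_union (v := Subtype.val ⁻¹' ⋃ q ∈ s \ {p}, V q)
      ((hV p).2.preimage continuous_subtype_val)
      ((isOpen_biUnion fun q _ => (hV q).2).preimage continuous_subtype_val) ?_ ?_ ⟨b, hbB, hbp⟩
    · refine Disjoint.preimage _ ?_
      rw [disjoint_iUnion₂_right]
      exact fun q hq => hdisj hp hq.1 (Ne.symm hq.2)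
    · intro y hy
      obtain ⟨q, hq, hyq⟩ := mem_iUnion₂.1 (hBV hy)
      by_cases hqp : q = p
      · left; rwa [hqp] at hyq
      · right; exact mem_iUnion₂.2 ⟨q, ⟨hq, hqp⟩, hyq⟩
  refine ⟨p, hp, fun W hW => ?_⟩
  have h1 := step (fun q => if q = p then interior W else V q) (fun q _ => by
    by_cases hqp : q = p
    · simp only [hqp, if_true]; exact ⟨isOpen_interior, mem_interior_iff_mem_nhds.2 hW⟩
    · simp only [hqp, if_false]; exact ⟨(hV q).2, (hV q).1⟩)
  rw [mem_map]
  filter_upwards [h1, hBF] with y hy hyB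
  obtain ⟨q, hq, hyq⟩ := mem_iUnion₂.1 hy
  by_cases hqp : q = p
  · simp only [hqp, if_true] at hyq; exact interior_subset (s := W) hyq
  · simp only [hqp, if_false] at hyq
    exact ((hdisj hp hq (Ne.symm hqp)).le_bot ⟨hBp hyB, hyq⟩).elim

theorem isConnected_punctured_ball {ε : ℝ} (hε : 0 < ε) :
    IsConnected (Metric.ball (0 : ℂ) ε \ {0}) := by
  have h : Metric.ball (0 : ℂ) ε \ {0} =
      (fun z : ℝ × ℝ => (z.1 : ℂ) * Complex.exp (z.2 * Complex.I)) '' (Ioo 0 ε ×ˢ univ) := by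
    ext z
    simp only [Set.mem_sdiff, mem_ball_zero_iff, mem_singleton_iff, mem_image, mem_prod, mem_Ioo,
      mem_univ, and_true, Prod.exists]
    constructor
    · rintro ⟨h1, h2⟩
      exact ⟨‖z‖, z.arg, ⟨norm_pos_iff.2 h2, h1⟩, Complex.norm_mul_exp_arg_mul_I z⟩
    · rintro ⟨r, t, ⟨h1, h2⟩, rfl⟩
      refine ⟨?_, ?_⟩
      · simpa [Complex.norm_exp_ofReal_mul_I, abs_of_pos h1] using h2
      · simpa using h1.ne'
  rw [h]
  refine (IsConnected.prod (isConnected_Ioo hε) isConnected_univ).image _ ?_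
  fun_prop

namespace TranslationSurface

variable {X : Type*} [TopologicalSpace X] (S : TranslationSurface X)

section

variable [T2Space X]

theorem exists_nhds_inter_sing (p : X) : ∃ N ∈ 𝓝 p, ∀ x ∈ N, x ∈ S.sing → x = p := by
  refine ⟨(S.sing \ {p})ᶜ, (S.sing_finite.subset sdiff_subset).isClosed.isOpen_compl.mem_nhds
    (by simp), fun x hx hxs => ?_⟩
  by_contra hne
  exact hx ⟨hxs, hne⟩

theorem isOpen_compl_sing : IsOpen {x : X | x ∉ S.sing} := S.sing_finite.isClosed.isOpen_compl

/-- The cone coordinate carries small punctured discs to punctured neighbourhoods of `p`, so each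
puncture is a single end of the regular part. -/
theorem exists_isConnected_punctured {p : X} (hp : p ∈ S.sing) {U : Set S.Reg}
    (hU : U ∈ comap Subtype.val (𝓝 p)) :
    ∃ B ∈ comap Subtype.val (𝓝 p), B ⊆ U ∧ IsConnected (B : Set S.Reg) := by
  obtain ⟨k, -, φ, hpφ, hφ0, -⟩ := S.cone p hp
  obtain ⟨W, hW, hWU⟩ := hU
  obtain ⟨N, hN, hNp⟩ := S.exists_nhds_inter_sing p
  have h0 : (0 : ℂ) ∈ φ.target := hφ0 ▸ φ.map_source hpφ
  have hsymm0 : φ.symm 0 = p := by rw [← hφ0, φ.left_inv hpφ]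
  have h1 : ∀ᶠ z in 𝓝 (0 : ℂ), z ∈ φ.target ∧ φ.symm z ∈ W ∩ N := by
    refine Filter.Eventually.and (φ.open_target.mem_nhds h0) ?_
    refine (φ.continuousAt_symm h0).eventually (?_ : ∀ᶠ x in 𝓝 (φ.symm 0), x ∈ W ∩ N)
    rw [hsymm0]
    exact inter_mem hW hN
  obtain ⟨ε, hε, hball⟩ := Metric.eventually_nhds_iff_ball.1 h1
  have hsub : φ.symm '' (Metric.ball 0 ε \ {0}) ⊆ {x | x ∉ S.sing} := by
    rintro _ ⟨z, ⟨hz, hz0⟩, rfl⟩ hs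
    have h2 := hNp _ (hball z hz).2.2 hs
    apply hz0
    rw [mem_singleton_iff, ← φ.right_inv (hball z hz).1, h2, hφ0]
  have hconn : IsConnected (φ.symm '' (Metric.ball 0 ε \ {0})) :=
    (isConnected_punctured_ball hε).image _
      (φ.continuousOn_symm.mono fun z hz => (hball z hz.1).1)
  have himg : (Subtype.val : S.Reg → X) '' (Subtype.val ⁻¹' (φ.symm '' (Metric.ball 0 ε \ {0})))
      = φ.symm '' (Metric.ball 0 ε \ {0}) := by
    rw [image_preimage_eq_inter_range, Subtype.range_coe_subtype, inter_eq_left]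
    exact hsub
  refine ⟨Subtype.val ⁻¹' (φ.symm '' (Metric.ball 0 ε \ {0})), ?_, ?_, ?_⟩
  · refine ⟨φ.symm '' Metric.ball 0 ε, ?_, ?_⟩
    · have := φ.symm.image_mem_nhds (x := 0) h0 (Metric.ball_mem_nhds 0 hε)
      rwa [hsymm0] at this
    · rintro y ⟨z, hz, hzy⟩
      refine ⟨z, ⟨hz, ?_⟩, hzy⟩
      rintro rfl
      rw [hsymm0] at hzy
      exact y.2 (hzy ▸ hp)
  · rintro y ⟨z, hz, hzy⟩
    apply hWU
    rw [mem_preimage, ← hzy]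
    exact (hball z hz.1).2.1
  · constructor
    · obtain ⟨x, hx⟩ := hconn.1
      exact ⟨⟨x, hsub hx⟩, hx⟩
    · rw [← IsEmbedding.subtypeVal.isInducing.isPreconnected_image, himg]
      exact hconn.2

theorem comap_nhds_neBot {p : X} (hp : p ∈ S.sing) :
    NeBot (comap (Subtype.val : S.Reg → X) (𝓝 p)) := by
  refine forall_mem_nonempty_iff_neBot.1 fun U hU => ?_
  obtain ⟨B, -, hBU, hB⟩ := S.exists_isConnected_punctured hp hU
  exact hB.1.mono hBU

theorem dense_compl_sing : Dense {x : X | x ∉ S.sing} := by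
  intro p
  by_cases hp : p ∈ S.sing
  · rw [mem_closure_iff_nhds]
    intro t ht
    have := S.comap_nhds_neBot hp
    obtain ⟨y, hy⟩ := Filter.nonempty_of_mem (preimage_mem_comap (m := (Subtype.val : S.Reg → X)) ht)
    exact ⟨y, hy, y.2⟩
  · exact subset_closure hp

/-- A compact regular part would be clopen in `X`, hence everything, but `sing` is non-empty. -/
theorem noncompactSpace_reg [PreconnectedSpace X] (x₀ : S.Reg) : NoncompactSpace S.Reg := by
  rw [← not_compactSpace_iff]
  intro h
  have hc : IsClosed {x : X | x ∉ S.sing} := (isCompact_iff_compactSpace.2 h).isClosed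
  have := IsClopen.eq_univ ⟨hc, S.isOpen_compl_sing⟩ ⟨x₀, x₀.2⟩
  obtain ⟨p, hp⟩ := S.sing_nonempty
  exact (this ▸ mem_univ p : p ∈ {x : X | x ∉ S.sing}) hp

variable [CompactSpace X]

/-- The image under `g` of the neighbourhood filter of the puncture keeps a basis of connected sets.
A cluster point `y` in the regular part would make `g.symm y` inseparable from `p`. So the image
filter converges to a puncture. -/
theorem exists_tendsto_homeomorph (g : S.Reg ≃ₜ S.Reg) {p : X} (hp : p ∈ S.sing) :
    ∃ p' ∈ S.sing, Tendsto (fun y => (g y : X)) (comap Subtype.val (𝓝 p)) (𝓝 p') := by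
  have := S.comap_nhds_neBot hp
  suffices h : ∃ p' ∈ S.sing, Tendsto Subtype.val (map g (comap Subtype.val (𝓝 p))) (𝓝 p') by
    obtain ⟨p', hp', h⟩ := h
    exact ⟨p', hp', tendsto_map'_iff.1 h⟩
  refine exists_tendsto_of_not_clusterPt S.sing_finite _ ?_ ?_
  · intro U hU
    obtain ⟨B, hB, hBU, hBc⟩ := S.exists_isConnected_punctured hp (mem_map.1 hU)
    exact ⟨g '' B, image_mem_map hB, image_subset_iff.2 hBU,
      (hBc.image g g.continuous.continuousOn).2⟩
  · intro y hy
    have hne : ((g.symm y : S.Reg) : X) ≠ p := fun h => (g.symm y).2 (h ▸ hp)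
    obtain ⟨A, B, hA, hB, hAy, hBp, hAB⟩ := t2_separation hne
    obtain ⟨z, hz1, hz2⟩ := clusterPt_iff_nonempty.1 hy (U := g.symm ⁻¹' (Subtype.val ⁻¹' A))
      ((hA.preimage (continuous_subtype_val.comp g.symm.continuous)).mem_nhds hAy)
      (V := g '' (Subtype.val ⁻¹' B))
      (image_mem_map (preimage_mem_comap (hB.mem_nhds hBp)))
    obtain ⟨u, hu, rfl⟩ := hz2
    simp only [mem_preimage, g.symm_apply_apply] at hz1
    exact hAB.le_bot ⟨hz1, hu⟩

theorem exists_continuous_extension (g : S.Reg ≃ₜ S.Reg) : ∃ f : X → X, Continuous f ∧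
    (∀ y : S.Reg, f y = g y) ∧ ∀ p ∈ S.sing, f p ∈ S.sing := by
  classical
  choose! e he1 he2 using fun p (hp : p ∈ S.sing) => S.exists_tendsto_homeomorph g hp
  let f : X → X := fun x => if hx : x ∈ S.sing then e x else g ⟨x, hx⟩
  have hf1 : ∀ x ∈ S.sing, f x = e x := fun x hx => dif_pos hx
  have hf2 : ∀ y : S.Reg, f y = g y := fun y => dif_neg y.2
  refine ⟨f, continuous_iff_continuousAt.2 fun x => ?_, hf2, fun p hp => hf1 p hp ▸ he1 p hp⟩
  by_cases hx : x ∈ S.sing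
  · intro W hW
    rw [hf1 x hx] at hW
    obtain ⟨N, hN, hNW⟩ := mem_comap.1 (he2 x hx hW)
    obtain ⟨N', hN', hNx⟩ := S.exists_nhds_inter_sing x
    rw [mem_map]
    filter_upwards [hN, hN'] with z hz hz'
    by_cases hzs : z ∈ S.sing
    · rw [hNx z hz' hzs, mem_preimage, hf1 x hx]; exact mem_of_mem_nhds hW
    · have : (⟨z, hzs⟩ : S.Reg) ∈ (fun y : S.Reg => (g y : X)) ⁻¹' W := hNW hz
      rw [mem_preimage, hf2 ⟨z, hzs⟩]
      exact this
  · have hc : ContinuousOn f {x | x ∉ S.sing} := by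
      rw [continuousOn_iff_continuous_domRestrict]
      exact (continuous_subtype_val.comp g.continuous).congr fun y => (hf2 y).symm
    exact hc.continuousAt (S.isOpen_compl_sing.mem_nhds hx)

/-- Every homeomorphism of the regular part extends to the surface. -/
theorem exists_onReg_eq (g : S.Reg ≃ₜ S.Reg) : ∃ f : S.HomeoGroup, S.onReg f = g := by
  obtain ⟨f, hf, hfg, hfs⟩ := S.exists_continuous_extension g
  obtain ⟨f', hf', hfg', -⟩ := S.exists_continuous_extension g.symm
  have h1 : Function.LeftInverse f' f := by
    refine congrFun (Continuous.ext_on S.dense_compl_sing (hf'.comp hf) continuous_id ?_)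
    intro x hx
    have := hfg' (g ⟨x, hx⟩)
    rw [← hfg, g.symm_apply_apply] at this
    exact this
  have h2 : Function.RightInverse f' f := by
    refine congrFun (Continuous.ext_on S.dense_compl_sing (hf.comp hf') continuous_id ?_)
    intro x hx
    have := hfg (g.symm ⟨x, hx⟩)
    rw [← hfg', g.apply_symm_apply] at this
    exact this
  refine ⟨⟨⟨⟨f, f', h1, h2⟩, hf, hf'⟩, fun x => ⟨fun hx => ?_, fun hx hxs => hx (hfs x hxs)⟩⟩, ?_⟩
  · change f x ∉ S.sing
    rw [hfg ⟨x, hx⟩]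
    exact (g _).2
  · ext y
    exact hfg y

end

end TranslationSurface

/-! ### The bottom boundary of a maximal cylinder -/

namespace TranslationStructure.Cylinder

variable {Y : Type*} [TopologicalSpace Y] {T : TranslationStructure Y} {θ : ℂ}

/-- The parametrization of the cylinder extends flatly below its bottom boundary, on the square
of radius `δ` around `(s, 0)`. -/
def ExtendsBelow (C : T.Cylinder θ) (s δ : ℝ) : Prop :=
  ∃ f : ℝ × ℝ → Y, T.FlatOn θ (Metric.ball (s, 0) δ) f ∧
    EqOn f C.param (Metric.ball (s, 0) δ ∩ strip 0 C.height)

theorem ExtendsBelow.mono {C : T.Cylinder θ} {s δ s' δ' : ℝ} (h : C.ExtendsBelow s δ)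
    (hs : |s' - s| + δ' ≤ δ) : C.ExtendsBelow s' δ' := by
  obtain ⟨f, hf, hfC⟩ := h
  have hsub : Metric.ball ((s', 0) : ℝ × ℝ) δ' ⊆ Metric.ball (s, 0) δ := by
    apply Metric.ball_subset_ball'
    rw [Prod.dist_eq, Real.dist_eq]
    simpa [add_comm] using hs
  exact ⟨f, hf.mono hsub, hfC.mono (inter_subset_inter_left _ hsub)⟩

theorem ExtendsBelow.add_width {C : T.Cylinder θ} {s δ : ℝ} (h : C.ExtendsBelow s δ) (n : ℤ) :
    C.ExtendsBelow (s + n * C.width) δ := by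
  obtain ⟨f, hf, hfC⟩ := h
  have hpre : ∀ z : ℝ × ℝ, z ∈ Metric.ball ((s + n * C.width, 0) : ℝ × ℝ) δ →
      z + (-(n * C.width), 0) ∈ Metric.ball ((s, 0) : ℝ × ℝ) δ := by
    intro z hz
    rw [mem_ball_prod] at hz ⊢
    convert hz using 3 <;> simp
    ring
  refine ⟨fun z => f (z + (-(n * C.width), 0)), (hf.comp_add _).mono hpre, fun z hz => ?_⟩
  have h1 : z + (-(n * C.width), 0) ∈ strip 0 C.height := by simpa [mem_strip] using hz.2
  simp only
  rw [hfC ⟨hpre z hz.1, h1⟩, C.param_eq_iff h1 hz.2]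
  exact ⟨by simp, -n, by simp⟩

/-- A flat square around the cluster point meets the descending ray at arbitrarily small heights.
Placed in the coordinates of the cylinder, it covers a square around `(s, 0)`. -/
theorem exists_extendsBelow_of_clusterPt [T2Space Y] {C : T.Cylinder θ} (hθ : θ ≠ 0) {s : ℝ}
    {y : Y} (hy : MapClusterPt y (𝓝[>] 0) fun t => C.param (s, t)) :
    ∃ δ > 0, C.ExtendsBelow s δ := by
  obtain ⟨r, hr, f, hf, rfl⟩ := T.exists_flatOn_ball θ y
  have hnhds : f '' Metric.ball 0 (r / 4) ∈ 𝓝 (f 0) :=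
    hf.image_mem_nhds hθ Metric.isOpen_ball (Metric.mem_ball_self hr)
      (Metric.ball_mem_nhds 0 (by linarith))
  have h1 := mapClusterPt_iff_frequently.1 hy _ hnhds
  have hh := C.height_pos
  -- The meeting point is off the centre by less than `r / 4` and its height `t` is below `r / 4`,
  -- so a square of radius `r / 2` around `(s, 0)` still fits into radius `r`.
  have h2 : ∀ᶠ t : ℝ in 𝓝[>] 0, t ∈ Ioo 0 (min (r / 4) C.height) :=
    Ioo_mem_nhdsGT (lt_min (by linarith) hh)
  obtain ⟨t, ⟨x, hx, hxt⟩, ht0, ht⟩ := (h1.and_eventually h2).exists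
  rw [lt_min_iff] at ht
  rw [mem_ball_zero_prod, abs_lt, abs_lt] at hx
  have hst : ((s, t) : ℝ × ℝ) ∈ Metric.ball ((s, 0) : ℝ × ℝ) (r / 2) ∩ strip 0 C.height := by
    refine ⟨?_, mem_strip.2 ⟨ht0, ht.2⟩⟩
    rw [mem_ball_prod]
    simp only [sub_self, abs_zero, sub_zero, abs_of_pos ht0]
    constructor <;> linarith
  have hg : T.FlatOn θ (Metric.ball ((s, 0) : ℝ × ℝ) (r / 2)) fun z => f (z + (x - (s, t))) := by
    refine (hf.comp_add _).mono fun z hz => ?_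
    rw [mem_ball_prod, abs_lt, abs_lt] at hz
    rw [mem_preimage, mem_ball_zero_prod, abs_lt, abs_lt]
    simp only [Prod.fst_add, Prod.fst_sub, Prod.snd_add, Prod.snd_sub] at hz ⊢
    refine ⟨⟨?_, ?_⟩, ?_, ?_⟩ <;> linarith [hz.1.1, hz.1.2, hz.2.1, hz.2.2, hx.1.1]
  refine ⟨r / 2, by linarith, _, hg, ?_⟩
  refine FlatOn.eqOn (Metric.isOpen_ball.inter (isOpen_strip _ _))
    ((convex_ball _ _).inter (convex_strip _ _)).isPreconnected (hg.mono inter_subset_left)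
    (C.flatOn.mono inter_subset_right) hst ?_
  simp only [add_sub_cancel]
  exact hxt

/-- Compactness of one period `[0, C.width]`, then translation by multiples of the width. -/
theorem exists_uniform_extendsBelow {C : T.Cylinder θ} (h : ∀ s, ∃ δ > 0, C.ExtendsBelow s δ) :
    ∃ δ > 0, ∀ s, C.ExtendsBelow s δ := by
  have key : ∃ δ > 0, ∀ s ∈ Icc 0 C.width, C.ExtendsBelow s δ := by
    refine isCompact_Icc.induction_on (p := fun A => ∃ δ > 0, ∀ s ∈ A, C.ExtendsBelow s δ)
      ⟨1, one_pos, by simp⟩ ?_ ?_ ?_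
    · rintro A B hAB ⟨δ, hδ, hB⟩
      exact ⟨δ, hδ, fun s hs => hB s (hAB hs)⟩
    · rintro A B ⟨δ, hδ, hA⟩ ⟨δ', hδ', hB⟩
      refine ⟨min δ δ', lt_min hδ hδ', ?_⟩
      rintro s (hs | hs)
      · exact (hA s hs).mono (by simp)
      · exact (hB s hs).mono (by simp)
    · intro s _
      obtain ⟨δ, hδ, hs⟩ := h s
      refine ⟨Metric.ball s (δ / 2), mem_nhdsWithin_of_mem_nhds
        (Metric.ball_mem_nhds s (by linarith)), δ / 2, by linarith, fun s' hs' => hs.mono ?_⟩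
      rw [Metric.mem_ball, Real.dist_eq] at hs'
      linarith
  obtain ⟨δ, hδ, hk⟩ := key
  refine ⟨δ, hδ, fun s => ?_⟩
  obtain ⟨n, hn⟩ := exists_sub_mul_mem_Icc C.width_pos s
  have := (hk _ hn).add_width (-n)
  simpa using this

/-- The parametrization of a maximal cylinder does not extend below all of its bottom boundary. -/
theorem IsMaximal.exists_not_extendsBelow [T2Space Y] [PreconnectedSpace Y] [NoncompactSpace Y]
    (hθ : θ ≠ 0) {C : T.Cylinder θ} (hC : C.IsMaximal) :
    ∃ s, ∀ δ > 0, ¬ C.ExtendsBelow s δ := by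
  classical
  by_contra hcon
  push Not at hcon
  obtain ⟨δ, hδ, h⟩ := exists_uniform_extendsBelow hcon
  choose f hf hfC using h
  have hh := C.height_pos
  let G : ℝ × ℝ → Y := fun z => if 0 < z.2 then C.param z else f z.1 z
  have hG1 : EqOn G C.param (strip 0 C.height) := fun z hz => if_pos (mem_strip.1 hz).1
  have hsub : strip 0 C.height ⊆ strip (-δ) C.height := by
    intro z hz
    rw [mem_strip] at hz ⊢
    constructor <;> linarith
  have hG2 : ∀ s, EqOn G (f s) (Metric.ball (s, 0) δ ∩ strip (-δ) C.height) := by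
    rintro s z ⟨hz, hz'⟩
    rw [mem_strip] at hz'
    by_cases hz0 : 0 < z.2
    · have : z ∈ strip 0 C.height := mem_strip.2 ⟨hz0, hz'.2⟩
      rw [hG1 this, hfC s ⟨hz, this⟩]
    · have h1 : G z = f z.1 z := if_neg hz0
      rw [h1]
      -- The point at height `η` lies in both squares and in the cylinder, where both extensions
      -- equal `C.param`; hence they agree wherever the squares overlap.
      set η := min δ C.height / 2
      have hη : 0 < η := half_pos (lt_min hδ hh)
      have hηδ : η < δ := (half_lt_self (lt_min hδ hh)).trans_le (min_le_left _ _)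
      have hηh : η < C.height := (half_lt_self (lt_min hδ hh)).trans_le (min_le_right _ _)
      rw [mem_ball_prod] at hz
      have hm : ((z.1, η) : ℝ × ℝ) ∈ Metric.ball ((z.1, 0) : ℝ × ℝ) δ ∩ Metric.ball (s, 0) δ := by
        constructor <;> rw [mem_ball_prod]
        · simp [hδ, abs_of_pos hη, hηδ]
        · exact ⟨hz.1, by simpa [abs_of_pos hη] using hηδ⟩
      have hms : ((z.1, η) : ℝ × ℝ) ∈ strip 0 C.height := mem_strip.2 ⟨hη, hηh⟩
      refine FlatOn.eqOn (Metric.isOpen_ball.inter Metric.isOpen_ball)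
        ((convex_ball _ _).inter (convex_ball _ _)).isPreconnected
        ((hf z.1).mono inter_subset_left) ((hf s).mono inter_subset_right) hm ?_ ⟨?_, ?_⟩
      · rw [hfC z.1 ⟨hm.1, hms⟩, hfC s ⟨hm.2, hms⟩]
      · rw [mem_ball_prod]
        exact ⟨by simp [hδ], hz.2⟩
      · rw [mem_ball_prod]; exact hz
  have hGf : T.FlatOn θ (strip (-δ) C.height) G := by
    apply FlatOn.of_locally
    intro x hx
    by_cases hx0 : 0 < x.2
    · exact ⟨_, C.param, isOpen_strip _ _, mem_strip.2 ⟨hx0, (mem_strip.1 hx).2⟩, C.flatOn, hG1⟩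
    · refine ⟨_, f x.1, Metric.isOpen_ball.inter (isOpen_strip _ _), ⟨?_, hx⟩,
        (hf x.1).mono inter_subset_left, hG2 x.1⟩
      rw [mem_ball_prod, abs_lt, abs_lt]
      have := (mem_strip.1 hx).1
      simp only [sub_self, sub_zero]
      refine ⟨⟨?_, ?_⟩, ?_, ?_⟩ <;> linarith
  have hz0 : ((0 : ℝ), C.height / 2) ∈ strip 0 C.height :=
    mem_strip.2 ⟨by simp; linarith, by simp; linarith⟩
  have hzw : ((0 : ℝ), C.height / 2) + (C.width, 0) ∈ strip 0 C.height := by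
    simpa [mem_strip] using hz0
  have hper : G ((0, C.height / 2) + (C.width, 0)) = G (0, C.height / 2) := by
    rw [hG1 hz0, hG1 hzw, C.param_eq_iff hzw hz0]
    exact ⟨by simp, 1, by simp⟩
  obtain ⟨D, -, -, -, hD⟩ := hGf.exists_cylinder hθ C.width_pos (hsub hz0) hper
  have h1 : D.carrier = C.carrier := by
    apply hC
    rw [hD]
    exact hG1.image_eq.symm.subset.trans (image_mono hsub)
  have hlow : ((0 : ℝ), -δ / 2) ∈ strip (-δ) C.height :=
    mem_strip.2 ⟨by simp; linarith, by simp; linarith⟩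
  have h2 : G (0, -δ / 2) ∈ C.carrier := by
    rw [← h1, hD]; exact mem_image_of_mem _ hlow
  obtain ⟨z, hz, hzG⟩ := h2
  rw [← hG1 hz] at hzG
  -- By maximality the point at height `-δ / 2` also occurs at a positive height, which a periodic
  -- strip forbids.
  have h3 := hGf.strip_height_eq hθ C.width_pos (hsub hz0) hper (hsub hz) hlow hzG
  have h4 := (mem_strip.1 hz).1
  simp at h3
  linarith

end TranslationStructure.Cylinder

/-! ### Finiteness of the maximal cylinders -/

namespace TranslationSurface

open TranslationStructure

variable {X : Type*} [TopologicalSpace X] (S : TranslationSurface X) {θ : ℂ}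

/-- The bottom boundary of a maximal cylinder contains a singularity or a marked point. -/
theorem exists_tendsto_sing [CompactSpace X] [T2Space X] [PreconnectedSpace S.Reg]
    [NoncompactSpace S.Reg] (hθ : θ ≠ 0) {C : S.flat.Cylinder θ} (hC : C.IsMaximal) :
    ∃ s : ℝ, ∃ p ∈ S.sing, Tendsto (fun t => (C.param (s, t) : X)) (𝓝[>] 0) (𝓝 p) := by
  obtain ⟨s, hs⟩ := hC.exists_not_extendsBelow hθ
  refine ⟨s, ?_⟩
  suffices h : ∃ p ∈ S.sing,
      Tendsto Subtype.val (map (fun t => C.param (s, t)) (𝓝[>] 0)) (𝓝 p) by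
    obtain ⟨p, hp, h⟩ := h
    exact ⟨p, hp, tendsto_map'_iff.1 h⟩
  refine exists_tendsto_of_not_clusterPt S.sing_finite _ ?_ ?_
  · intro U hU
    have hU' := inter_mem (mem_map.1 hU) (Ioo_mem_nhdsGT C.height_pos)
    obtain ⟨ε, hε, hεU⟩ := mem_nhdsGT_iff_exists_Ioo_subset.1 hU'
    refine ⟨(fun t => C.param (s, t)) '' Ioo 0 ε, image_mem_map (Ioo_mem_nhdsGT hε),
      image_subset_iff.2 fun t ht => (hεU ht).1, ?_⟩
    refine isPreconnected_Ioo.image _ (C.flatOn.1.comp (by fun_prop) fun t ht => ?_)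
    exact mem_strip.2 (hεU ht).2
  · intro y hy
    obtain ⟨δ, hδ, h⟩ := Cylinder.exists_extendsBelow_of_clusterPt hθ hy
    exact hs δ hδ h

/-- Along the vertical ray both `φ ^ k` and `t i θ` are flat coordinates, so their difference is
constant. Both tend to `0` at the cone point, so the constant is `0`. -/
theorem eventually_cone_pow_eq {C : S.flat.Cylinder θ} {s : ℝ} {p : X}
    (hCp : Tendsto (fun t => (C.param (s, t) : X)) (𝓝[>] 0) (𝓝 p)) {k : ℕ} (hk : 1 ≤ k)
    {φ : OpenPartialHomeomorph X ℂ} (hpφ : p ∈ φ.source) (hφ0 : φ p = 0)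
    (hφ : ∀ y : S.Reg, (y : X) ∈ φ.source → ∀ e ∈ S.flat.atlas, y ∈ e.source →
      ∃ c : ℂ, ∀ᶠ z in 𝓝 y, e z = φ (z : X) ^ k + c) :
    ∀ᶠ t in 𝓝[>] (0 : ℝ), (C.param (s, t) : X) ∈ φ.source ∧
      φ (C.param (s, t) : X) ^ k = (t : ℂ) * Complex.I * θ := by
  have h1 : ∀ᶠ t in 𝓝[>] (0 : ℝ), (C.param (s, t) : X) ∈ φ.source ∧ t ∈ Ioo 0 C.height :=
    Filter.Eventually.and (hCp (φ.open_source.mem_nhds hpφ)) (Ioo_mem_nhdsGT C.height_pos)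
  obtain ⟨ε, hε, hεU⟩ := mem_nhdsGT_iff_exists_Ioo_subset.1 h1
  let g : ℝ → ℂ := fun t => φ (C.param (s, t) : X) ^ k - (t : ℂ) * Complex.I * θ
  have hloc : ∀ t ∈ Ioo 0 ε, ∀ᶠ u in 𝓝 t, g u = g t := by
    intro t ht
    have hts : ((s, t) : ℝ × ℝ) ∈ strip 0 C.height := mem_strip.2 (hεU ht).2
    obtain ⟨e, he, hes, c, hc⟩ := C.flatOn.exists_chart (isOpen_strip _ _) hts
    obtain ⟨c', hc'⟩ := hφ _ (hεU ht).1 e he hes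
    have h2 := (C.flatOn.continuousAt (isOpen_strip _ _) hts).eventually hc'
    have h3 : Tendsto (fun u : ℝ => (s, u)) (𝓝 t) (𝓝 (s, t)) :=
      (by fun_prop : Continuous fun u : ℝ => (s, u)).tendsto t
    have h4 : ∀ᶠ u in 𝓝 t, g u = s * θ + c - c' := by
      filter_upwards [h3.eventually hc, h3.eventually h2] with u hu1 hu2
      have h5 := hu1.2
      rw [hu2] at h5
      simp only [g, dev] at h5 ⊢
      linear_combination h5
    filter_upwards [h4] with u hu
    rw [hu, h4.self_of_nhds]
  have : PreconnectedSpace (Ioo 0 ε) := isPreconnected_iff_preconnectedSpace.1 isPreconnected_Ioo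
  have hconst : IsLocallyConstant fun t : Ioo 0 ε => g t := by
    rw [IsLocallyConstant.iff_eventually_eq]
    exact fun t => (continuous_subtype_val.tendsto t).eventually (hloc t t.2)
  have hε' : 0 < ε := hε
  have hmid : ε / 2 ∈ Ioo 0 ε := ⟨by linarith, by linarith⟩
  have heq : ∀ t ∈ Ioo 0 ε, g t = g (ε / 2) := fun t ht =>
    hconst.apply_eq_of_preconnectedSpace ⟨t, ht⟩ ⟨ε / 2, hmid⟩
  have hlim : Tendsto g (𝓝[>] 0) (𝓝 0) := by
    have h2 : Tendsto (fun t => φ (C.param (s, t) : X)) (𝓝[>] 0) (𝓝 0) := by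
      have := (φ.continuousAt hpφ).tendsto.comp hCp
      rwa [hφ0] at this
    have h3 : Tendsto (fun t : ℝ => (t : ℂ) * Complex.I * θ) (𝓝[>] 0) (𝓝 0) := by
      have : Continuous fun t : ℝ => (t : ℂ) * Complex.I * θ := by fun_prop
      simpa using (this.tendsto 0).mono_left nhdsWithin_le_nhds
    have := (h2.pow k).sub h3
    rwa [zero_pow (by omega), sub_zero] at this
  have hlim' : Tendsto g (𝓝[>] 0) (𝓝 (g (ε / 2))) := by
    refine tendsto_const_nhds.congr' ?_
    filter_upwards [Ioo_mem_nhdsGT hε'] with t ht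
    exact (heq t ht).symm
  have h0 := tendsto_nhds_unique hlim' hlim
  filter_upwards [Ioo_mem_nhdsGT hε'] with t ht
  refine ⟨(hεU ht).1, ?_⟩
  have := heq t ht
  rw [h0] at this
  exact sub_eq_zero.1 this

/-- A translation surface has finitely many maximal cylinders in a given direction. -/
theorem finite_maximal_carriers [CompactSpace X] [T2Space X] [PreconnectedSpace S.Reg]
    [NoncompactSpace S.Reg] (hθ : θ ≠ 0) :
    {A : Set S.Reg | ∃ C : S.flat.Cylinder θ, C.IsMaximal ∧ C.carrier = A}.Finite := by
  classical
  have key : ∀ p ∈ S.sing, {A : Set S.Reg | ∃ C : S.flat.Cylinder θ, ∃ s : ℝ, C.IsMaximal ∧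
      C.carrier = A ∧ Tendsto (fun t => (C.param (s, t) : X)) (𝓝[>] 0) (𝓝 p)}.Finite := by
    intro p hp
    obtain ⟨k, hk, φ, hpφ, hφ0, hφ⟩ := S.cone p hp
    by_contra hinf
    -- At one small common height `t`, `k + 1` distinct cylinders would give `k + 1` distinct `k`-th
    -- roots of `t i θ`: equal roots mean equal points, and maximal cylinders that meet coincide.
    obtain ⟨F, hF, hcard⟩ := Set.Infinite.exists_subset_card_eq hinf (k + 1)
    choose C s hC hcar htend using fun A : F => hF A.2
    have h1 : ∀ᶠ t in 𝓝[>] (0 : ℝ), ∀ A : F, (((C A).param (s A, t) : X) ∈ φ.source ∧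
        φ ((C A).param (s A, t) : X) ^ k = (t : ℂ) * Complex.I * θ) ∧ t ∈ Ioo 0 (C A).height := by
      rw [eventually_all]
      exact fun A => (S.eventually_cone_pow_eq (htend A) hk hpφ hφ0 hφ).and
        (Ioo_mem_nhdsGT (C A).height_pos)
    obtain ⟨t, ht⟩ := h1.exists
    have hinj : Function.Injective fun A : F => φ ((C A).param (s A, t) : X) := by
      intro A B hAB
      have h2 := Subtype.ext (φ.injOn (ht A).1.1 (ht B).1.1 hAB)
      have h3 := ((hC A).eq_of_param_eq hθ (hC B) (z := (s A, t)) (z' := (s B, t))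
        (mem_strip.2 (ht A).2) (mem_strip.2 (ht B).2) h2).2.2.2.1
      rw [hcar, hcar] at h3
      exact Subtype.ext h3
    have h4 : F.card ≤ (Polynomial.nthRoots k ((t : ℂ) * Complex.I * θ)).toFinset.card := by
      rw [← Fintype.card_coe, ← Finset.card_univ]
      refine Finset.card_le_card_of_injOn _ (fun A _ => ?_) hinj.injOn
      rw [Finset.mem_coe, Multiset.mem_toFinset, Polynomial.mem_nthRoots (by omega)]
      exact (ht A).1.2
    have h5 := (Multiset.toFinset_card_le _).trans
      (Polynomial.card_nthRoots k ((t : ℂ) * Complex.I * θ))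
    omega
  refine (S.sing_finite.biUnion key).subset ?_
  rintro A ⟨C, hC, rfl⟩
  obtain ⟨s, p, hp, h⟩ := S.exists_tendsto_sing hθ hC
  exact mem_iUnion₂.2 ⟨p, hp, C, s, hC, rfl, h⟩

end TranslationSurface

/-! ### Neighbourhoods of points on the cylinder boundaries -/

namespace TranslationStructure

variable {Y : Type*} [TopologicalSpace Y] {T : TranslationStructure Y} {θ : ℂ}

theorem dev_neg_direction (θ : ℂ) (z : ℝ × ℝ) : dev (-θ) z = -dev θ z := by simp [dev]

theorem dev_neg (θ : ℂ) (z : ℝ × ℝ) : dev θ (-z) = -dev θ z := by simp [dev]; ring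

theorem FlatOn.comp_neg {U : Set (ℝ × ℝ)} {f : ℝ × ℝ → Y} (hf : T.FlatOn θ U f) :
    T.FlatOn (-θ) ((fun z => -z) ⁻¹' U) (fun z => f (-z)) := by
  refine ⟨hf.1.comp (by fun_prop) (mapsTo_preimage _ _), fun x hx e he hxe => ?_⟩
  obtain ⟨c, hc⟩ := hf.2 (-x) hx e he hxe
  refine ⟨c, ?_⟩
  filter_upwards [(continuous_neg.tendsto x).eventually hc] with z hz
  rw [hz, dev_neg_direction, dev_neg]

namespace Cylinder

theorem neg_add_mem_strip {h : ℝ} {z : ℝ × ℝ} : -z + (0, h) ∈ strip 0 h ↔ z ∈ strip 0 h := by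
  simp only [mem_strip, Prod.snd_add, Prod.snd_neg]
  constructor <;> rintro ⟨h1, h2⟩ <;> constructor <;> linarith

/-- The cylinder with the opposite direction. -/
def reverse (C : T.Cylinder θ) {θ' : ℂ} (hθ' : θ' = -θ) : T.Cylinder θ' where
  width := C.width
  height := C.height
  width_pos := C.width_pos
  height_pos := C.height_pos
  param z := C.param (-z + (0, C.height))
  continuousOn := C.flatOn.1.comp (by fun_prop) fun z hz => neg_add_mem_strip.2 hz
  flat := by
    subst hθ'
    exact ((C.flatOn.comp_add (0, C.height)).comp_neg.mono
      fun z hz => neg_add_mem_strip.2 hz : T.FlatOn (-θ) (strip 0 C.height) _).2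
  eq_iff x hx z hz := by
    rw [C.param_eq_iff (neg_add_mem_strip.2 hx) (neg_add_mem_strip.2 hz)]
    simp only [Prod.snd_add, Prod.snd_neg, Prod.fst_add, Prod.fst_neg, add_zero,
      add_left_inj, neg_inj]
    refine and_congr_right fun _ => ⟨?_, ?_⟩
    · rintro ⟨n, hn⟩
      exact ⟨-n, by push_cast; linarith⟩
    · rintro ⟨n, hn⟩
      exact ⟨-n, by push_cast; linarith⟩

theorem carrier_reverse (C : T.Cylinder θ) {θ' : ℂ} (hθ' : θ' = -θ) :
    (C.reverse hθ').carrier = C.carrier := by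
  apply Subset.antisymm
  · rintro _ ⟨z, hz, rfl⟩
    exact C.param_mem (neg_add_mem_strip.2 hz)
  · rintro _ ⟨z, hz, rfl⟩
    refine ⟨-z + (0, C.height), neg_add_mem_strip.2 hz, ?_⟩
    change C.param (-(-z + (0, C.height)) + (0, C.height)) = C.param z
    congr 1
    abel

theorem IsMaximal.reverse {C : T.Cylinder θ} (hC : C.IsMaximal) {θ' : ℂ} (hθ' : θ' = -θ) :
    (C.reverse hθ').IsMaximal := by
  intro C' h
  rw [carrier_reverse] at h ⊢
  have := hC (C'.reverse (by rw [hθ', neg_neg])) (by rwa [carrier_reverse])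
  rwa [carrier_reverse] at this

/-- A flat map of a convex set which meets a cylinder agrees with its parametrization. -/
theorem eq_param_of_flatOn [T2Space Y] (C : T.Cylinder θ) {U : Set (ℝ × ℝ)} (hU : IsOpen U)
    (hc : Convex ℝ U) {f : ℝ × ℝ → Y} (hf : T.FlatOn θ U f) {z₀ z₁ : ℝ × ℝ} (hz₀ : z₀ ∈ U)
    (hz₁ : z₁ ∈ strip 0 C.height) (h : f z₀ = C.param z₁) {z : ℝ × ℝ} (hz : z ∈ U)
    (hz' : z + (z₁ - z₀) ∈ strip 0 C.height) : f z = C.param (z + (z₁ - z₀)) :=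
  FlatOn.eqOn (hU.inter ((isOpen_strip 0 C.height).preimage (f := fun x => x + (z₁ - z₀))
    (by fun_prop)))
    (hc.inter ((convex_strip _ _).translate_preimage_left (z₁ - z₀))).isPreconnected
    (hf.mono inter_subset_left) ((C.flatOn.comp_add (z₁ - z₀)).mono inter_subset_right)
    (x := z₀) ⟨hz₀, by simpa using hz₁⟩ (by simpa using h) ⟨hz, hz'⟩

/-- A cylinder contains the full horizontal line through each of its points. -/
theorem notMem_carrier_of_flatOn [T2Space Y] (C : T.Cylinder θ) {r : ℝ} {f : ℝ × ℝ → Y}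
    (hf : T.FlatOn θ (Metric.ball 0 r) f) (h0 : f 0 ∉ C.carrier) {z : ℝ × ℝ}
    (hz : z ∈ Metric.ball 0 r) (hz2 : z.2 = 0) : f z ∉ C.carrier := by
  rintro ⟨z₁, hz₁, h⟩
  have hr : 0 < r := (norm_nonneg z).trans_lt (mem_ball_zero_iff.1 hz)
  have hm : (0 : ℝ × ℝ) + (z₁ - z) ∈ strip 0 C.height := by
    have : z₁ ∈ strip 0 C.height := hz₁
    simpa [mem_strip, hz2] using this
  rw [C.eq_param_of_flatOn Metric.isOpen_ball (convex_ball _ _) hf hz hz₁ h.symm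
    (Metric.mem_ball_self hr) hm] at h0
  exact h0 (C.param_mem hm)

end Cylinder

/-- If finitely many maximal cylinders have closures covering the surface, then just above a
point outside of all of them there is a single one of them. -/
theorem exists_cylinder_above [T2Space Y] (hθ : θ ≠ 0)
    (hfin : {A : Set Y | ∃ C : T.Cylinder θ, C.IsMaximal ∧ C.carrier = A}.Finite)
    (hcov : ∀ y : Y, ∃ C : T.Cylinder θ, C.IsMaximal ∧ y ∈ closure C.carrier)
    {r : ℝ} (hr : 0 < r) {f : ℝ × ℝ → Y} (hf : T.FlatOn θ (Metric.ball 0 r) f)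
    (h0 : ∀ C : T.Cylinder θ, C.IsMaximal → f 0 ∉ C.carrier) :
    ∃ C : T.Cylinder θ, C.IsMaximal ∧ ∃ a ρ : ℝ, 0 < ρ ∧ ∀ z ∈ Metric.ball (0 : ℝ × ℝ) (min r ρ),
      0 < z.2 → z.2 < C.height ∧ f z = C.param (z.1 + a, z.2) := by
  -- Pigeonhole: the cylinders are dense in every thin band above the point, and there are finitely
  -- many carriers, so one is met at heights accumulating at `0`.
  obtain ⟨C, hC, hfreq⟩ : ∃ C : T.Cylinder θ, C.IsMaximal ∧ ∃ᶠ t in 𝓝[>] (0 : ℝ),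
      ∃ z ∈ Metric.ball (0 : ℝ × ℝ) r, z.2 = t ∧ f z ∈ C.carrier := by
    by_contra hcon
    push Not at hcon
    have h1 : ∀ᶠ t in 𝓝[>] (0 : ℝ), ∀ A ∈ {A : Set Y | ∃ C : T.Cylinder θ,
        C.IsMaximal ∧ C.carrier = A}, ∀ z ∈ Metric.ball (0 : ℝ × ℝ) r, z.2 = t → f z ∉ A := by
      rw [eventually_all_finite hfin]
      rintro _ ⟨C, hC, rfl⟩
      exact hcon C hC
    obtain ⟨ε, hε, h2⟩ := mem_nhdsGT_iff_exists_Ioo_subset.1 h1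
    have hε' : 0 < ε := hε
    set t := min ε r / 2
    have ht : 0 < t := half_pos (lt_min hε' hr)
    have htε : t < ε := (half_lt_self (lt_min hε' hr)).trans_le (min_le_left _ _)
    have htr : t < r := (half_lt_self (lt_min hε' hr)).trans_le (min_le_right _ _)
    have hm : ((0 : ℝ), t) ∈ Metric.ball (0 : ℝ × ℝ) r ∩ strip 0 ε :=
      ⟨by rw [mem_ball_zero_prod]; simp [hr, abs_of_pos ht, htr], mem_strip.2 ⟨ht, htε⟩⟩
    obtain ⟨C, hC, hcl⟩ := hcov (f (0, t))
    obtain ⟨_, ⟨z, hz, rfl⟩, hzC⟩ := mem_closure_iff.1 hcl _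
      ((hf.mono inter_subset_left).isOpen_image hθ (Metric.isOpen_ball.inter (isOpen_strip _ _)))
      (mem_image_of_mem f hm)
    exact h2 (mem_strip.1 hz.2) C.carrier ⟨C, hC, rfl⟩ z hz.1 rfl hzC
  have hh := C.height_pos
  have h0' := h0 C hC
  -- If the height in `C` exceeded the height in the square, sliding down to the centre would remain
  -- in `C`, against `h0'`.
  have hoff : ∀ z₀ ∈ Metric.ball (0 : ℝ × ℝ) r, ∀ z₁ ∈ strip 0 C.height, 0 < z₀.2 →
      f z₀ = C.param z₁ → z₁.2 ≤ z₀.2 := by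
    intro z₀ hz₀ z₁ hz₁ hpos h
    by_contra hlt
    push Not at hlt
    have h1 := mem_strip.1 hz₁
    have hm : (0 : ℝ × ℝ) + (z₁ - z₀) ∈ strip 0 C.height :=
      mem_strip.2 ⟨by simp; linarith, by simp; linarith⟩
    rw [C.eq_param_of_flatOn Metric.isOpen_ball (convex_ball _ _) hf hz₀ hz₁ h
      (Metric.mem_ball_self hr) hm] at h0'
    exact h0' (C.param_mem hm)
  have hlt : 0 < min r C.height := lt_min hr hh
  obtain ⟨_, ⟨z₀, hz₀, rfl, z₁, hz₁, h1⟩, ht0⟩ :=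
    (hfreq.and_eventually (Ioo_mem_nhdsGT hlt)).exists
  have hz₁' := mem_strip.1 hz₁
  have ht0' := lt_min_iff.1 ht0.2
  have hle := hoff z₀ hz₀ z₁ hz₁ ht0.1 h1.symm
  -- If it were smaller, a meeting `w₀` at a much lower level, followed upwards to `z₀`, would give
  -- `f z₀` a second, larger height in `C`.
  have heq : z₁.2 = z₀.2 := by
    by_contra hne
    have hpos : 0 < z₀.2 - z₁.2 := sub_pos.2 (lt_of_le_of_ne hle hne)
    obtain ⟨_, ⟨w₀, hw₀, rfl, w₁, hw₁, h2⟩, hu0⟩ :=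
      (hfreq.and_eventually (Ioo_mem_nhdsGT hpos)).exists
    have hle' := hoff w₀ hw₀ w₁ hw₁ hu0.1 h2.symm
    have hw₁' := mem_strip.1 hw₁
    have hm : z₀ + (w₁ - w₀) ∈ strip 0 C.height :=
      mem_strip.2 ⟨by simp; linarith [hu0.2], by simp; linarith⟩
    have h3 := C.eq_param_of_flatOn Metric.isOpen_ball (convex_ball _ _) hf hw₀ hw₁ h2.symm hz₀ hm
    rw [← h1, C.param_eq_iff hz₁ hm] at h3
    have h4 := h3.1
    simp at h4
    linarith [hu0.2]
  refine ⟨C, hC, z₁.1 - z₀.1, C.height, hh, fun z hz hz2 => ?_⟩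
  have hzr : z ∈ Metric.ball (0 : ℝ × ℝ) r := Metric.ball_subset_ball (min_le_left _ _) hz
  have hzh : z.2 < C.height := by
    rw [mem_ball_zero_prod, lt_min_iff, lt_min_iff] at hz
    exact (le_abs_self _).trans_lt hz.2.2
  have hv : z + (z₁ - z₀) = (z.1 + (z₁.1 - z₀.1), z.2) := by ext <;> simp [heq]
  refine ⟨hzh, ?_⟩
  rw [← hv]
  exact C.eq_param_of_flatOn Metric.isOpen_ball (convex_ball _ _) hf hz₀ hz₁ h1.symm hzr
    (by rw [hv]; exact mem_strip.2 ⟨hz2, hzh⟩)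

/-- Around a point outside of all maximal cylinders, there is a single maximal cylinder above and
a single one below. -/
def HasSplitBoundary (T : TranslationStructure Y) (θ : ℂ) : Prop :=
  ∀ y : Y, (∀ C : T.Cylinder θ, C.IsMaximal → y ∉ C.carrier) →
    ∃ r > 0, ∃ f : ℝ × ℝ → Y, T.FlatOn θ (Metric.ball 0 r) f ∧ f 0 = y ∧
      (∃ C : T.Cylinder θ, C.IsMaximal ∧ ∃ a : ℝ, ∀ z ∈ Metric.ball (0 : ℝ × ℝ) r, 0 < z.2 →
        z.2 < C.height ∧ f z = C.param (z.1 + a, z.2)) ∧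
      (∃ C : T.Cylinder θ, C.IsMaximal ∧ ∃ a : ℝ, ∀ z ∈ Metric.ball (0 : ℝ × ℝ) r, z.2 < 0 →
        0 < z.2 + C.height ∧ f z = C.param (z.1 + a, z.2 + C.height))

/-- A half-turn of the square exchanges `θ` with `-θ` and above with below, so one construction
gives both sides. -/
theorem hasSplitBoundary_of_finite [T2Space Y] (hθ : θ ≠ 0)
    (hfin : {A : Set Y | ∃ C : T.Cylinder θ, C.IsMaximal ∧ C.carrier = A}.Finite)
    (hcov : ∀ y : Y, ∃ C : T.Cylinder θ, C.IsMaximal ∧ y ∈ closure C.carrier) :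
    T.HasSplitBoundary θ := by
  intro y hy
  obtain ⟨r, hr, f, hf, rfl⟩ := T.exists_flatOn_ball θ y
  obtain ⟨C, hC, a, ρ, hρ, hup⟩ := exists_cylinder_above hθ hfin hcov hr hf hy
  have hball : (fun z : ℝ × ℝ => -z) ⁻¹' Metric.ball 0 r = Metric.ball 0 r := by
    ext z; simp
  have hf' := hf.comp_neg
  rw [hball] at hf'
  have hfin' : {A : Set Y | ∃ C : T.Cylinder (-θ), C.IsMaximal ∧ C.carrier = A}.Finite := by
    refine hfin.subset ?_
    rintro _ ⟨C, hC, rfl⟩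
    exact ⟨C.reverse (neg_neg θ).symm, hC.reverse _, C.carrier_reverse _⟩
  have hcov' : ∀ y : Y, ∃ C : T.Cylinder (-θ), C.IsMaximal ∧ y ∈ closure C.carrier := by
    intro y
    obtain ⟨C, hC, h⟩ := hcov y
    exact ⟨C.reverse rfl, hC.reverse rfl, by rwa [C.carrier_reverse]⟩
  obtain ⟨C', hC', a', ρ', hρ', hdown⟩ := exists_cylinder_above (neg_ne_zero.2 hθ) hfin' hcov' hr
    hf' (fun C hC => by
      have := hy _ (hC.reverse (neg_neg θ).symm)
      rw [C.carrier_reverse] at this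
      simpa using this)
  refine ⟨min r (min ρ ρ'), lt_min hr (lt_min hρ hρ'), f,
    hf.mono (Metric.ball_subset_ball (min_le_left _ _)), rfl, ⟨C, hC, a, fun z hz => ?_⟩,
    ⟨C'.reverse (neg_neg θ).symm, hC'.reverse _, -a', fun z hz hz2 => ?_⟩⟩
  · exact hup z (Metric.ball_subset_ball (min_le_min_left _ (min_le_left _ _)) hz)
  · have h1 := hdown (-z) (by
      have := Metric.ball_subset_ball (min_le_min_left _ (min_le_right _ _)) hz
      simpa using this) (by simpa using hz2)
    rw [neg_neg] at h1
    have hC'h : (C'.reverse (neg_neg θ).symm).height = C'.height := rfl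
    rw [hC'h]
    refine ⟨by have := h1.1; simp at this; linarith, ?_⟩
    rw [h1.2]
    change _ = C'.param (-(z.1 + -a', z.2 + C'.height) + (0, C'.height))
    congr 1
    ext
    · simp [add_comm]
    · simp

/-! ### Shears and the twist along all maximal cylinders -/

/-- The affine shear of the plane. -/
def shear (μ : ℝ) (z : ℝ × ℝ) : ℝ × ℝ := (z.1 + μ * z.2, z.2)

theorem continuous_shear (μ : ℝ) : Continuous (shear μ) := by unfold shear; fun_prop

theorem shear_mem_strip {μ a b : ℝ} {z : ℝ × ℝ} : shear μ z ∈ strip a b ↔ z ∈ strip a b := by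
  simp [mem_strip, shear]

theorem dev_shear (hθ : ‖θ‖ = 1) (μ : ℝ) (z : ℝ × ℝ) :
    dev θ (shear μ z) = parabolicMap θ μ (dev θ z) := by
  have h1 : (starRingEnd ℂ θ * dev θ z).im = z.2 := by
    have h2 : starRingEnd ℂ θ * θ = 1 := by
      rw [mul_comm, Complex.mul_conj, Complex.normSq_eq_norm_sq, hθ]; simp
    have h3 : starRingEnd ℂ θ * dev θ z = (z.1 : ℂ) + (z.2 : ℂ) * Complex.I := by
      simp only [dev]
      linear_combination ((z.1 : ℂ) + (z.2 : ℂ) * Complex.I) * h2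
    rw [h3]; simp
  have h4 : parabolicMap θ μ (dev θ z) =
      dev θ z + ((μ * (starRingEnd ℂ θ * dev θ z).im : ℝ) : ℂ) * θ := rfl
  rw [h4, h1]
  simp only [dev, shear]
  push_cast
  ring

/-- `D` is in flat coordinates around each point the shear with parameter `μ`. -/
def IsLocallyShear (T : TranslationStructure Y) (θ : ℂ) (μ : ℝ) (D : Y → Y) : Prop :=
  ∀ y : Y, ∃ (U V : Set (ℝ × ℝ)) (z₀ : ℝ × ℝ) (f g : ℝ × ℝ → Y), IsOpen U ∧ IsOpen V ∧ z₀ ∈ U ∧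
    shear μ z₀ ∈ V ∧ T.FlatOn θ U f ∧ T.FlatOn θ V g ∧ f z₀ = y ∧
    ∀ᶠ z in 𝓝 z₀, D (f z) = g (shear μ z)

theorem IsLocallyShear.continuous (hθ : θ ≠ 0) {μ : ℝ} {D : Y → Y}
    (hD : T.IsLocallyShear θ μ D) : Continuous D := by
  rw [continuous_iff_continuousAt]
  intro y
  obtain ⟨U, V, z₀, f, g, hU, hV, hz₀, hz₀V, hf, hg, rfl, h⟩ := hD y
  have h1 : Tendsto (fun z => g (shear μ z)) (𝓝 z₀) (𝓝 (g (shear μ z₀))) :=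
    (hg.continuousAt hV hz₀V).tendsto.comp ((continuous_shear μ).tendsto z₀)
  rw [ContinuousAt, ← hf.map_nhds hθ hU hz₀, tendsto_map'_iff, h.self_of_nhds]
  exact h1.congr' (h.mono fun z hz => hz.symm)

theorem IsLocallyShear.isAffineWith (hθ : ‖θ‖ = 1) {μ : ℝ} {D : Y → Y}
    (hD : T.IsLocallyShear θ μ D) : T.IsAffineWith D (parabolicMap θ μ) := by
  have hθ0 : θ ≠ 0 := by rintro rfl; simp at hθ
  intro y e he e' he' hy hy'
  obtain ⟨U, V, z₀, f, g, hU, hV, hz₀, hz₀V, hf, hg, rfl, h⟩ := hD y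
  rw [h.self_of_nhds] at hy'
  obtain ⟨c, hc⟩ := hf.2 z₀ hz₀ e he hy
  obtain ⟨c', hc'⟩ := hg.2 _ hz₀V e' he' hy'
  refine ⟨c' - parabolicMap θ μ c, ?_⟩
  rw [← hf.map_nhds hθ0 hU hz₀, eventually_map]
  filter_upwards [h, hc, ((continuous_shear μ).tendsto z₀).eventually hc'] with z h1 h2 h3
  rw [h1, h2, h3, dev_shear hθ, map_add]
  ring

open Classical in
/-- The shear with parameter `μ` of all the maximal cylinders in direction `θ`, extended by the
identity. -/
def twist (T : TranslationStructure Y) (θ : ℂ) (μ : ℝ) (y : Y) : Y :=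
  if h : ∃ p : T.Cylinder θ × (ℝ × ℝ), p.1.IsMaximal ∧ p.2 ∈ strip 0 p.1.height ∧
      p.1.param p.2 = y then
    h.choose.1.param (shear μ h.choose.2)
  else y

theorem twist_of_notMem {μ : ℝ} {y : Y}
    (hy : ∀ C : T.Cylinder θ, C.IsMaximal → y ∉ C.carrier) : T.twist θ μ y = y := by
  refine dif_neg ?_
  rintro ⟨⟨C, z⟩, hC, hz, h⟩
  exact hy C hC ⟨z, hz, h⟩

section

variable [T2Space Y] [PreconnectedSpace Y] [NoncompactSpace Y]

/-- The choice in `twist` is harmless: two maximal parametrizations of a point differ by a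
horizontal translation, which commutes with the shear. -/
theorem twist_param (hθ : θ ≠ 0) {C : T.Cylinder θ} (hC : C.IsMaximal) (μ : ℝ)
    {z : ℝ × ℝ} (hz : z ∈ strip 0 C.height) :
    T.twist θ μ (C.param z) = C.param (shear μ z) := by
  have h : ∃ p : T.Cylinder θ × (ℝ × ℝ), p.1.IsMaximal ∧ p.2 ∈ strip 0 p.1.height ∧
      p.1.param p.2 = C.param z := ⟨(C, z), hC, hz, rfl⟩
  have h1 : T.twist θ μ (C.param z) = h.choose.1.param (shear μ h.choose.2) := dif_pos h
  obtain ⟨h2, h3, h4⟩ := h.choose_spec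
  obtain ⟨-, -, h5, -, h6⟩ := h2.eq_of_param_eq hθ hC h3 hz h4
  rw [h1, h6 _ (shear_mem_strip.2 h3)]
  congr 1
  ext
  · simp [shear, h5]; ring
  · simp [shear, h5]

theorem twist_neg_twist (hθ : θ ≠ 0) (μ : ℝ) (y : Y) :
    T.twist θ (-μ) (T.twist θ μ y) = y := by
  by_cases hy : ∃ C : T.Cylinder θ, C.IsMaximal ∧ y ∈ C.carrier
  · obtain ⟨C, hC, z, hz, rfl⟩ := hy
    rw [twist_param hθ hC μ hz, twist_param hθ hC _ (shear_mem_strip.2 hz)]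
    congr 1
    ext <;> simp [shear]
  · push Not at hy
    rw [twist_of_notMem hy, twist_of_notMem hy]

/-- At a boundary point the three regions match one shear. Above, heights in the square and in the
cylinder agree. Below, they differ by `C'.height`, which adds the displacement `μ * C'.height = k *
C'.width`, a multiple of the period. On the horizontal itself both maps are the identity. -/
theorem isLocallyShear_twist (hθ : θ ≠ 0) {μ : ℝ} (hsplit : T.HasSplitBoundary θ)
    (hμ : ∀ C : T.Cylinder θ, C.IsMaximal → ∃ k : ℤ, k * C.modulus = μ) :
    T.IsLocallyShear θ μ (T.twist θ μ) := by
  intro y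
  by_cases hy : ∃ C : T.Cylinder θ, C.IsMaximal ∧ y ∈ C.carrier
  · obtain ⟨C, hC, z, hz, rfl⟩ := hy
    refine ⟨_, _, z, C.param, C.param, isOpen_strip _ _, isOpen_strip _ _, hz,
      shear_mem_strip.2 hz, C.flatOn, C.flatOn, rfl, ?_⟩
    filter_upwards [(isOpen_strip 0 C.height).mem_nhds hz] with w hw
    exact twist_param hθ hC μ hw
  · push Not at hy
    obtain ⟨r, hr, f, hf, rfl, ⟨C, hC, a, hup⟩, ⟨C', hC', a', hdown⟩⟩ := hsplit y hy
    have h0 : (0 : ℝ × ℝ) ∈ Metric.ball (0 : ℝ × ℝ) r := Metric.mem_ball_self hr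
    have hs0 : shear μ 0 = 0 := by simp [shear]
    refine ⟨_, _, 0, f, f, Metric.isOpen_ball, Metric.isOpen_ball, h0, by rwa [hs0], hf, hf, rfl,
      ?_⟩
    have h1 : ∀ᶠ z in 𝓝 (0 : ℝ × ℝ), shear μ z ∈ Metric.ball (0 : ℝ × ℝ) r :=
      ((continuous_shear μ).tendsto 0).eventually (Metric.isOpen_ball.mem_nhds (by rwa [hs0]))
    filter_upwards [h1, Metric.isOpen_ball.mem_nhds h0] with z hz1 hz2
    rcases lt_trichotomy z.2 0 with hlt | heq | hgt
    · have h2 := hdown z hz2 hlt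
      have h3 := hdown (shear μ z) hz1 hlt
      obtain ⟨k, hk⟩ := hμ C' hC'
      have hmem : ((z.1 + a', z.2 + C'.height) : ℝ × ℝ) ∈ strip 0 C'.height :=
        mem_strip.2 ⟨h2.1, by simp; linarith⟩
      have hmem' : (((shear μ z).1 + a', (shear μ z).2 + C'.height) : ℝ × ℝ) ∈
          strip 0 C'.height := mem_strip.2 ⟨h2.1, by simp [shear]; linarith⟩
      rw [h2.2, h3.2, twist_param hθ hC' μ hmem,
        C'.param_eq_iff (shear_mem_strip.2 hmem) hmem']
      refine ⟨rfl, k, ?_⟩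
      have h4 : μ * C'.height = k * C'.width := by
        rw [← hk, Cylinder.modulus, mul_assoc, div_mul_cancel₀ _ C'.height_pos.ne']
      simp only [shear]
      linear_combination h4
    · have h2 : shear μ z = z := by ext <;> simp [shear, heq]
      rw [h2, twist_of_notMem]
      exact fun C hC => C.notMem_carrier_of_flatOn hf (hy C hC) hz2 heq
    · have h2 := hup z hz2 hgt
      have h3 := hup (shear μ z) hz1 hgt
      rw [h2.2, h3.2, twist_param hθ hC μ (z := (z.1 + a, z.2)) (mem_strip.2 ⟨hgt, h2.1⟩)]
      congr 1
      ext <;> simp [shear]; ring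

/-- The twist as a homeomorphism. -/
def twistHomeomorph (hθ : θ ≠ 0) {μ : ℝ} (hsplit : T.HasSplitBoundary θ)
    (hμ : ∀ C : T.Cylinder θ, C.IsMaximal → ∃ k : ℤ, k * C.modulus = μ) : Y ≃ₜ Y where
  toFun := T.twist θ μ
  invFun := T.twist θ (-μ)
  left_inv := twist_neg_twist hθ μ
  right_inv y := by
    have := twist_neg_twist (T := T) hθ (-μ) y
    rwa [neg_neg] at this
  continuous_toFun := (isLocallyShear_twist hθ hsplit hμ).continuous hθ
  continuous_invFun := by
    refine (isLocallyShear_twist hθ hsplit fun C hC => ?_).continuous hθ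
    obtain ⟨k, hk⟩ := hμ C hC
    exact ⟨-k, by rw [← hk]; push_cast; ring⟩

theorem eq_twist_of_continuous (hθ : θ ≠ 0) {μ : ℝ} (hsplit : T.HasSplitBoundary θ)
    (hμ : ∀ C : T.Cylinder θ, C.IsMaximal → ∃ k : ℤ, k * C.modulus = μ)
    (hcov : ∀ y : Y, ∃ C : T.Cylinder θ, C.IsMaximal ∧ y ∈ closure C.carrier)
    {D : Y → Y} (hD : Continuous D)
    (hDC : ∀ C : T.Cylinder θ, C.IsMaximal → ∀ z ∈ strip 0 C.height,
      D (C.param z) = C.param (shear μ z)) : D = T.twist θ μ := by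
  have hdense : Dense (⋃ C ∈ {C : T.Cylinder θ | C.IsMaximal}, C.carrier) := by
    intro y
    obtain ⟨C, hC, hy⟩ := hcov y
    exact closure_mono (subset_biUnion_of_mem (u := fun C : T.Cylinder θ => C.carrier) hC) hy
  refine Continuous.ext_on hdense hD ((isLocallyShear_twist hθ hsplit hμ).continuous hθ) ?_
  intro y hy
  obtain ⟨C, hC, z, hz, rfl⟩ := mem_iUnion₂.1 hy
  rw [hDC C hC z hz, twist_param hθ hC μ hz]

end

end TranslationStructure

/-! ### Common multiples, determinants and traces -/

theorem exists_common_integer_multiple {M : Set ℝ} (hM : M.Finite) (hpos : ∀ m ∈ M, 0 < m)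
    (hrat : ∀ m ∈ M, ∀ m' ∈ M, ∃ r : ℚ, m = r * m') :
    ∃ μ > 0, ∀ m ∈ M, ∃ k : ℤ, k * m = μ := by
  rcases M.eq_empty_or_nonempty with rfl | ⟨m₀, hm₀⟩
  · exact ⟨1, one_pos, by simp⟩
  have key : ∃ q : ℕ, 0 < q ∧ ∀ m ∈ M, ∃ k : ℤ, k * m = q * m₀ := by
    refine hM.induction_on_subset _ (motive := fun A _ => ∃ q : ℕ, 0 < q ∧ ∀ m ∈ A,
      ∃ k : ℤ, k * m = q * m₀) ⟨1, one_pos, by simp⟩ ?_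
    rintro m A hm - - ⟨q, hq, hA⟩
    obtain ⟨r, hr⟩ := hrat m₀ hm₀ m hm
    have hr' : (r.num : ℝ) * m = r.den * m₀ := by
      have h1 : (r : ℝ) * r.den = r.num := by exact_mod_cast Rat.mul_den_eq_num r
      rw [hr, ← h1]; ring
    -- `q` collects the denominators of the ratios `m₀ / m`.
    refine ⟨q * r.den, Nat.mul_pos hq r.den_pos, ?_⟩
    rintro m' (rfl | hm')
    · exact ⟨q * r.num, by push_cast; rw [mul_assoc, hr']; ring⟩
    · obtain ⟨k, hk⟩ := hA m' hm'
      exact ⟨k * r.den, by push_cast; linear_combination (r.den : ℝ) * hk⟩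
  obtain ⟨q, hq, hk⟩ := key
  have := hpos m₀ hm₀
  exact ⟨q * m₀, by positivity, hk⟩

theorem det_parabolicMap (θ : ℂ) (μ : ℝ) : LinearMap.det (parabolicMap θ μ) = 1 := by
  rw [← LinearMap.det_toMatrix Complex.basisOneI, Matrix.det_fin_two]
  simp [LinearMap.toMatrix_apply, parabolicMap]
  ring

/-- The square is that of the cross product of the directions, positive when they are not parallel;
parameters of opposite signs then push the trace above `2`. -/
theorem trace_parabolicMap_comp (θ₁ θ₂ : ℂ) (μ₁ μ₂ : ℝ) :
    LinearMap.trace ℝ ℂ (parabolicMap θ₁ μ₁ ∘ₗ parabolicMap θ₂ μ₂) =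
      2 - μ₁ * μ₂ * (θ₁.re * θ₂.im - θ₁.im * θ₂.re) ^ 2 := by
  rw [LinearMap.trace_eq_matrix_trace ℝ Complex.basisOneI, Matrix.trace_fin_two]
  simp [LinearMap.toMatrix_apply, parabolicMap]
  ring

theorem cross_ne_zero_of_linearIndependent {θ₁ θ₂ : ℂ} (h : LinearIndependent ℝ ![θ₁, θ₂]) :
    θ₁.re * θ₂.im - θ₁.im * θ₂.re ≠ 0 := by
  rw [LinearIndependent.pair_iff] at h
  intro h0
  obtain ⟨h1, h2⟩ := h θ₂.re (-θ₁.re) (by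
    apply Complex.ext
    · simp; ring
    · simp; linear_combination -h0)
  obtain ⟨h3, h4⟩ := h θ₂.im (-θ₁.im) (by
    apply Complex.ext
    · simp; linear_combination h0
    · simp; ring)
  obtain ⟨h5, -⟩ := h 1 0 (by
    apply Complex.ext
    · simpa using h2
    · simpa using h4)
  exact one_ne_zero h5

theorem TranslationStructure.IsAffineWith.comp {Y : Type*} [TopologicalSpace Y]
    {T : TranslationStructure Y} {f g : Y → Y} {A B : ℂ →ₗ[ℝ] ℂ} (hf : T.IsAffineWith f A)
    (hg : T.IsAffineWith g B) (hgc : Continuous g) : T.IsAffineWith (f ∘ g) (A ∘ₗ B) := by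
  intro y e he e' he' hy hy'
  obtain ⟨a, ha, hya⟩ := T.cover (g y)
  obtain ⟨c, hc⟩ := hg y e he a ha hy hya
  obtain ⟨c', hc'⟩ := hf (g y) a ha e' he' hya hy'
  refine ⟨A c + c', ?_⟩
  filter_upwards [hc, (hgc.tendsto y).eventually hc'] with z h1 h2
  simp only [Function.comp, LinearMap.comp_apply]
  rw [h2, h1, map_add]
  ring

/-! ### Homogeneous lifts of twists -/

namespace ZdCover

open TranslationStructure

variable {Y : Type*} [TopologicalSpace Y] {x₀ : Y} {d : ℕ}
  {ζ : FirstHomology Y x₀ →+ (Fin d → ℤ)} {E : Type*} [TopologicalSpace E]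
  {T : TranslationStructure Y} {θ : ℂ}

theorem map_loopClass_eq (P : ZdCover ζ E) {x : E} {n : Fin d → ℤ} (Γ : Path x (P.deck n x))
    {y : Y} (hy : P.proj x = y) (γ : Path y y) (δ : Path x₀ y)
    (h : ∀ t, γ t = P.proj (Γ t)) : ζ (loopClass δ γ) = n := by
  subst hy
  exact P.monodromy x n Γ γ δ h

/-- A homeomorphism with a homogeneous lift preserves the homomorphism of the cover. -/
theorem HasHomogeneousLift.preservesHom {P : ZdCover ζ E} {f : Y ≃ₜ Y}
    (h : P.HasHomogeneousLift f) : PreservesHom ζ f := by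
  obtain ⟨F, hF, hFd⟩ := h
  intro y γ δ δ'
  obtain ⟨x, hx⟩ := P.surjective y
  obtain ⟨Γ, hΓ, hΓ0⟩ := P.isCoveringMap.exists_path_lifts γ.toContinuousMap x (by simp [hx])
  have hΓt : ∀ t, P.proj (Γ t) = γ t := fun t => congrFun hΓ t
  obtain ⟨n, hn⟩ := (P.fibre x (Γ 1)).1 (by rw [hΓt, hx, γ.target])
  let Γ' : Path x (P.deck n x) := ⟨Γ, hΓ0, hn.symm⟩
  rw [P.map_loopClass_eq Γ' hx γ δ fun t => (hΓt t).symm]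
  -- `F` carries the lift of `γ` to a lift of `f ∘ γ` from `F x` to `F (P.deck n x) = P.deck n (F
  -- x)`, so the same `n` is read off.
  refine P.map_loopClass_eq ((Γ'.map F.continuous).cast rfl (hFd n x).symm)
    (by rw [hF, hx]) _ δ' fun t => ?_
  change f (γ t) = P.proj (F (Γ t))
  rw [hF, hΓt]

theorem HasHomogeneousLift.trans {P : ZdCover ζ E} {f g : Y ≃ₜ Y}
    (hf : P.HasHomogeneousLift f) (hg : P.HasHomogeneousLift g) :
    P.HasHomogeneousLift (f.trans g) := by
  obtain ⟨F, hF, hFd⟩ := hf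
  obtain ⟨G, hG, hGd⟩ := hg
  refine ⟨F.trans G, fun x => ?_, fun n x => ?_⟩
  · simp [hG, hF]
  · simp [hFd, hGd]

variable [T2Space Y] [NoncompactSpace Y]

/-- The maximal cylinders of the base are covered by those of the cover. -/
theorem exists_maximal_over (P : ZdCover ζ E) (hθ : θ ≠ 0) (hper : (P.flat T).IsPeriodic θ)
    {C : T.Cylinder θ} {x : E} (hx : P.proj x ∈ C.carrier) :
    ∃ C' : (P.flat T).Cylinder θ, C'.IsMaximal ∧ x ∈ C'.carrier := by
  obtain ⟨C', hC', hmeet⟩ := P.exists_maximal_meet hθ hper C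
  have hsub := P.subset_projCylinder hθ hC' hmeet
  have h1 := hsub hx
  rw [carrier_projCylinder] at h1
  obtain ⟨x', hx', hxx'⟩ := h1
  obtain ⟨n, rfl⟩ := (P.fibre x' x).1 hxx'
  refine ⟨P.deckCylinder n C', P.isMaximal_deckCylinder n hC', ?_⟩
  rw [carrier_deckCylinder]
  exact mem_image_of_mem _ hx'

/-- No finiteness is needed upstairs: the flat square of the base lifts, and a sample point in each
half picks a maximal cylinder whose projection is the one below up to a horizontal translation, so
the heights agree. -/
theorem hasSplitBoundary (P : ZdCover ζ E) (hθ : θ ≠ 0) (hper : (P.flat T).IsPeriodic θ)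
    (hsplit : T.HasSplitBoundary θ) : (P.flat T).HasSplitBoundary θ := by
  have := P.t2Space
  have := P.pathConnectedSpace_base
  intro x hx
  obtain ⟨r, hr, f, hf, hf0, ⟨C, hC, a, hup⟩, ⟨D, hD, b, hdown⟩⟩ := hsplit (P.proj x)
    fun C hC hxC => by
      obtain ⟨C', hC', hxC'⟩ := P.exists_maximal_over hθ hper hxC
      exact hx C' hC' hxC'
  obtain ⟨F, hF, hF0, hFp⟩ := hf.exists_lift P.isCoveringMap Metric.isOpen_ball (convex_ball _ _)
    (Metric.mem_ball_self hr) hf0.symm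
  change (P.flat T).FlatOn θ _ F at hF
  refine ⟨r, hr, F, hF, hF0, ?_, ?_⟩
  · have hz₀ : ((0 : ℝ), r / 2) ∈ Metric.ball (0 : ℝ × ℝ) r := by
      rw [mem_ball_zero_prod, abs_of_pos (half_pos hr)]; simp [hr]
    set z₀ : ℝ × ℝ := (0, r / 2) with hz₀'
    have hpos : 0 < z₀.2 := half_pos hr
    have h1 := hup z₀ hz₀ hpos
    have hm : ((z₀.1 + a, z₀.2) : ℝ × ℝ) ∈ strip 0 C.height := mem_strip.2 ⟨hpos, h1.1⟩
    have h2 : P.proj (F z₀) = C.param (z₀.1 + a, z₀.2) := by rw [hFp _ hz₀, h1.2]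
    obtain ⟨C', hC', z₁, hz₁, h3⟩ :=
      P.exists_maximal_over hθ hper (x := F z₀) (h2 ▸ C.param_mem hm)
    have h4 : (P.projCylinder hθ C').param z₁ = C.param (z₀.1 + a, z₀.2) := by
      rw [← h2, ← h3]; rfl
    obtain ⟨-, hhe, h5, -, -⟩ :=
      (P.isMaximal_projCylinder hθ hC').eq_of_param_eq hθ hC hz₁ hm h4
    change C'.height = C.height at hhe
    refine ⟨C', hC', z₁.1 - z₀.1, fun z hz hz2 => ?_⟩
    have h6 := (hup z hz hz2).1
    have hv : z + (z₁ - z₀) = (z.1 + (z₁.1 - z₀.1), z.2) := by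
      simp only at h5
      ext <;> simp [h5]
    refine ⟨hhe ▸ h6, ?_⟩
    rw [← hv]
    exact C'.eq_param_of_flatOn Metric.isOpen_ball (convex_ball _ _) hF hz₀ hz₁ h3.symm hz
      (by rw [hv]; exact mem_strip.2 ⟨hz2, hhe ▸ h6⟩)
  · have hz₀ : ((0 : ℝ), -(r / 2)) ∈ Metric.ball (0 : ℝ × ℝ) r := by
      rw [mem_ball_zero_prod, abs_neg, abs_of_pos (half_pos hr)]; simp [hr]
    set z₀ : ℝ × ℝ := (0, -(r / 2)) with hz₀'
    have hneg : z₀.2 < 0 := neg_lt_zero.2 (half_pos hr)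
    have h1 := hdown z₀ hz₀ hneg
    have hm : ((z₀.1 + b, z₀.2 + D.height) : ℝ × ℝ) ∈ strip 0 D.height :=
      mem_strip.2 ⟨h1.1, by simp only; linarith⟩
    have h2 : P.proj (F z₀) = D.param (z₀.1 + b, z₀.2 + D.height) := by rw [hFp _ hz₀, h1.2]
    obtain ⟨C', hC', z₁, hz₁, h3⟩ :=
      P.exists_maximal_over hθ hper (x := F z₀) (h2 ▸ D.param_mem hm)
    have h4 : (P.projCylinder hθ C').param z₁ = D.param (z₀.1 + b, z₀.2 + D.height) := by
      rw [← h2, ← h3]; rfl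
    obtain ⟨-, hhe, h5, -, -⟩ :=
      (P.isMaximal_projCylinder hθ hC').eq_of_param_eq hθ hD hz₁ hm h4
    change C'.height = D.height at hhe
    refine ⟨C', hC', z₁.1 - z₀.1, fun z hz hz2 => ?_⟩
    have h6 := (hdown z hz hz2).1
    have hv : z + (z₁ - z₀) = (z.1 + (z₁.1 - z₀.1), z.2 + C'.height) := by
      simp only at h5
      ext
      · simp
      · simp [h5, hhe]
    refine ⟨hhe ▸ h6, ?_⟩
    rw [← hv]
    exact C'.eq_param_of_flatOn Metric.isOpen_ball (convex_ball _ _) hF hz₀ hz₁ h3.symm hz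
      (by rw [hv]; exact mem_strip.2 ⟨hhe ▸ h6, by simp only; linarith⟩)

/-- Projections of maximal cylinders are maximal, and points off all maximal cylinders upstairs
project off all those downstairs. -/
theorem proj_twist (P : ZdCover ζ E) (hθ : θ ≠ 0) (hper : (P.flat T).IsPeriodic θ) (μ : ℝ)
    (x : E) : P.proj ((P.flat T).twist θ μ x) = T.twist θ μ (P.proj x) := by
  have := P.t2Space
  have := P.pathConnectedSpace_base
  have := P.noncompactSpace
  have := P.preconnectedSpace
  by_cases hx : ∃ C : (P.flat T).Cylinder θ, C.IsMaximal ∧ x ∈ C.carrier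
  · obtain ⟨C, hC, z, hz, rfl⟩ := hx
    rw [twist_param hθ hC μ hz]
    exact (twist_param hθ (P.isMaximal_projCylinder hθ hC) μ hz).symm
  · push Not at hx
    rw [twist_of_notMem hx, twist_of_notMem]
    intro C hC hxC
    obtain ⟨C', hC', hxC'⟩ := P.exists_maximal_over hθ hper hxC
    exact hx C' hC' hxC'

theorem twist_deck (P : ZdCover ζ E) (hθ : θ ≠ 0) (μ : ℝ) (n : Fin d → ℤ) (x : E) :
    (P.flat T).twist θ μ (P.deck n x) = P.deck n ((P.flat T).twist θ μ x) := by
  have := P.t2Space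
  have := P.noncompactSpace
  have := P.preconnectedSpace
  by_cases hx : ∃ C : (P.flat T).Cylinder θ, C.IsMaximal ∧ x ∈ C.carrier
  · obtain ⟨C, hC, z, hz, rfl⟩ := hx
    rw [twist_param hθ hC μ hz]
    exact twist_param hθ (P.isMaximal_deckCylinder n hC) μ hz
  · push Not at hx
    rw [twist_of_notMem hx, twist_of_notMem]
    intro C hC hxC
    refine hx _ (P.isMaximal_deckCylinder (-n) hC) ?_
    rw [carrier_deckCylinder]
    exact ⟨_, hxC, P.deck_neg_deck n x⟩

/-- A homeomorphism of the base which is a twist has a homogeneous lift. -/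
theorem hasHomogeneousLift_of_eq_twist (P : ZdCover ζ E) (hθ : θ ≠ 0)
    (hper : (P.flat T).IsPeriodic θ) (hsplit : T.HasSplitBoundary θ) {μ : ℝ}
    (hμ : ∀ C : T.Cylinder θ, C.IsMaximal → ∃ k : ℤ, k * C.modulus = μ) {f : Y ≃ₜ Y}
    (hf : ⇑f = T.twist θ μ) : P.HasHomogeneousLift f := by
  have := P.t2Space
  have := P.pathConnectedSpace_base
  have := P.noncompactSpace
  have := P.preconnectedSpace
  refine ⟨twistHomeomorph hθ (P.hasSplitBoundary hθ hper hsplit)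
    (fun C hC => hμ _ (P.isMaximal_projCylinder hθ hC)), fun x => ?_, fun n x => ?_⟩
  · rw [hf]; exact P.proj_twist hθ hper μ x
  · exact P.twist_deck hθ μ n x

end ZdCover

/-! ### Dehn twists of the surface and their products -/

namespace TranslationSurface

open TranslationStructure

theorem IsDehnTwist.isPseudoAnosov_mul {X : Type*} [TopologicalSpace X]
    {S : TranslationSurface X} {θ₁ θ₂ : ℂ} (hne : LinearIndependent ℝ ![θ₁, θ₂])
    {μ₁ μ₂ : ℝ} (hμ : μ₁ * μ₂ < 0) {D₁ D₂ : S.HomeoGroup} (h₁ : S.IsDehnTwist θ₁ μ₁ D₁)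
    (h₂ : S.IsDehnTwist θ₂ μ₂ D₂) : S.IsPseudoAnosov (D₁ * D₂) := by
  refine ⟨parabolicMap θ₁ μ₁ ∘ₗ parabolicMap θ₂ μ₂,
    h₁.2.2.1.comp h₂.2.2.1 (S.onReg D₂).continuous, ?_, ?_⟩
  · rw [LinearMap.det_comp, det_parabolicMap, det_parabolicMap, one_mul]
  · rw [trace_parabolicMap_comp]
    have := pow_pos (abs_pos.2 (cross_ne_zero_of_linearIndependent hne)) 2
    rw [sq_abs] at this
    nlinarith

variable {X : Type*} [TopologicalSpace X] [CompactSpace X] [T2Space X]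
  (S : TranslationSurface X) [PreconnectedSpace S.Reg] [NoncompactSpace S.Reg] {θ : ℂ}

theorem hasSplitBoundary (hθ : θ ≠ 0) (hper : S.flat.IsPeriodic θ) :
    S.flat.HasSplitBoundary θ :=
  hasSplitBoundary_of_finite hθ (S.finite_maximal_carriers hθ) hper.1

theorem exists_common_multiple_modulus (hθ : θ ≠ 0) (hper : S.flat.IsPeriodic θ) :
    ∃ μ > 0, ∀ C : S.flat.Cylinder θ, C.IsMaximal → ∃ k : ℤ, k * C.modulus = μ := by
  have hfin : {m : ℝ | ∃ C : S.flat.Cylinder θ, C.IsMaximal ∧ C.modulus = m}.Finite := by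
    classical
    -- The modulus depends only on the carrier, so finitely many carriers give finitely many moduli;
    -- the value `0` is never used.
    refine ((S.finite_maximal_carriers hθ).image fun A => if h : ∃ C : S.flat.Cylinder θ,
      C.IsMaximal ∧ C.carrier = A then h.choose.modulus else 0).subset ?_
    rintro _ ⟨C, hC, rfl⟩
    refine ⟨C.carrier, ⟨C, hC, rfl⟩, ?_⟩
    have h : ∃ C' : S.flat.Cylinder θ, C'.IsMaximal ∧ C'.carrier = C.carrier := ⟨C, hC, rfl⟩
    have hm : C.param (0, C.height / 2) ∈ h.choose.carrier := by
      rw [h.choose_spec.2]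
      have := C.height_pos
      exact C.param_mem (mem_strip.2 ⟨by simp; linarith, by simp; linarith⟩)
    obtain ⟨z, hz, hzC⟩ := hm
    obtain ⟨h1, h2, -⟩ := h.choose_spec.1.eq_of_param_eq hθ hC hz
      (mem_strip.2 ⟨by simp; linarith [C.height_pos], by simp; linarith [C.height_pos]⟩) hzC
    simp only [dif_pos h, Cylinder.modulus, h1, h2]
  obtain ⟨μ, hμ, h⟩ := exists_common_integer_multiple hfin
    (by rintro _ ⟨C, -, rfl⟩; exact div_pos C.width_pos C.height_pos)
    (by rintro _ ⟨C, hC, rfl⟩ _ ⟨C', hC', rfl⟩; exact hper.2 C C' hC hC')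
  exact ⟨μ, hμ, fun C hC => h _ ⟨C, hC, rfl⟩⟩

theorem exists_isDehnTwist (hθ : ‖θ‖ = 1) (hper : S.flat.IsPeriodic θ) {μ : ℝ} (hμ0 : μ ≠ 0)
    (hμ : ∀ C : S.flat.Cylinder θ, C.IsMaximal → ∃ k : ℤ, k * C.modulus = μ) :
    ∃ D : S.HomeoGroup, S.IsDehnTwist θ μ D := by
  have hθ0 : θ ≠ 0 := by rintro rfl; simp at hθ
  have hsplit := S.hasSplitBoundary hθ0 hper
  obtain ⟨D, hD⟩ := S.exists_onReg_eq (twistHomeomorph hθ0 hsplit hμ)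
  refine ⟨D, hμ0, hper, ?_, fun C hC => ⟨hμ C hC, fun s t ht => ?_⟩⟩
  · rw [hD]
    exact (isLocallyShear_twist hθ0 hsplit hμ).isAffineWith hθ
  · rw [hD]
    exact twist_param hθ0 hC μ (z := (s, t)) (mem_strip.2 ht)

variable {S}

theorem IsDehnTwist.eq_twist {μ : ℝ} {D : S.HomeoGroup} (hθ : θ ≠ 0)
    (hD : S.IsDehnTwist θ μ D) : ⇑(S.onReg D) = S.flat.twist θ μ :=
  eq_twist_of_continuous hθ (S.hasSplitBoundary hθ hD.2.1) (fun C hC => (hD.2.2.2 C hC).1)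
    hD.2.1.1 (S.onReg D).continuous fun C hC z hz => (hD.2.2.2 C hC).2 z.1 z.2 (mem_strip.1 hz)

theorem IsDehnTwist.hasHomogeneousLift {x₀ : S.Reg} {d : ℕ}
    {ζ : FirstHomology S.Reg x₀ →+ (Fin d → ℤ)} {E : Type*} [TopologicalSpace E]
    (P : ZdCover ζ E) {μ : ℝ} {D : S.HomeoGroup} (hθ : θ ≠ 0)
    (hper : (P.flat S.flat).IsPeriodic θ) (hD : S.IsDehnTwist θ μ D) :
    P.HasHomogeneousLift (S.onReg D) :=
  P.hasHomogeneousLift_of_eq_twist hθ hper (S.hasSplitBoundary hθ hD.2.1)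
    (fun C hC => (hD.2.2.2 C hC).1) (hD.eq_twist hθ)

end TranslationSurface
end

/-! ### The main theorem -/

theorem mainTheorem9 {X : Type*} [TopologicalSpace X] [CompactSpace X] [ConnectedSpace X]
    [T2Space X] (S : TranslationSurface X) {d : ℕ} (x₀ : S.Reg)
    (ζ : FirstHomology S.Reg x₀ →+ (Fin d → ℤ))
    {E : Type*} [TopologicalSpace E] (P : ZdCover ζ E)
    (θ₁ θ₂ : ℂ) (hθ₁ : ‖θ₁‖ = 1) (hθ₂ : ‖θ₂‖ = 1) (hne : LinearIndependent ℝ ![θ₁, θ₂])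
    (hor₁ : (P.flat S.flat).HasFiniteHorizon θ₁) (hor₂ : (P.flat S.flat).HasFiniteHorizon θ₂)
    (per₁ : (P.flat S.flat).IsPeriodic θ₁) (per₂ : (P.flat S.flat).IsPeriodic θ₂) :
    (∃ D₁ D₂ : S.HomeoGroup, ∃ μ₁ μ₂ : ℝ, 0 < μ₁ ∧ μ₂ < 0 ∧
      S.IsDehnTwist θ₁ μ₁ D₁ ∧ S.IsDehnTwist θ₂ μ₂ D₂) ∧
    (∀ (D : S.HomeoGroup) (μ : ℝ), S.IsDehnTwist θ₁ μ D ∨ S.IsDehnTwist θ₂ μ D →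
      PreservesHom ζ (S.onReg D) ∧ P.HasHomogeneousLift (S.onReg D)) ∧
    (∀ (D₁ D₂ : S.HomeoGroup) (μ₁ μ₂ : ℝ), S.IsDehnTwist θ₁ μ₁ D₁ → S.IsDehnTwist θ₂ μ₂ D₂ →
      μ₁ * μ₂ < 0 →
      S.IsPseudoAnosov (D₁ * D₂) ∧ PreservesHom ζ (S.onReg (D₁ * D₂)) ∧
        P.HasHomogeneousLift (S.onReg (D₁ * D₂))) := by
  have hθ₁0 : θ₁ ≠ 0 := by rintro rfl; simp at hθ₁
  have hθ₂0 : θ₂ ≠ 0 := by rintro rfl; simp at hθ₂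
  have := S.noncompactSpace_reg x₀
  have := P.pathConnectedSpace_base
  have hp₁ := P.isPeriodic_base hθ₁0 per₁
  have hp₂ := P.isPeriodic_base hθ₂0 per₂
  refine ⟨?_, ?_, ?_⟩
  · obtain ⟨μ₁, hμ₁, h₁⟩ := S.exists_common_multiple_modulus hθ₁0 hp₁
    obtain ⟨μ₂, hμ₂, h₂⟩ := S.exists_common_multiple_modulus hθ₂0 hp₂
    obtain ⟨D₁, hD₁⟩ := S.exists_isDehnTwist hθ₁ hp₁ hμ₁.ne' h₁
    -- Common multiples are unaffected by sign, so the second twist may run backwards.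
    obtain ⟨D₂, hD₂⟩ := S.exists_isDehnTwist hθ₂ hp₂ (μ := -μ₂) (neg_ne_zero.2 hμ₂.ne')
      fun C hC => by
        obtain ⟨k, hk⟩ := h₂ C hC
        exact ⟨-k, by rw [← hk]; push_cast; ring⟩
    exact ⟨D₁, D₂, μ₁, -μ₂, hμ₁, neg_lt_zero.2 hμ₂, hD₁, hD₂⟩
  · rintro D μ (hD | hD)
    · have h := hD.hasHomogeneousLift P hθ₁0 per₁
      exact ⟨h.preservesHom, h⟩
    · have h := hD.hasHomogeneousLift P hθ₂0 per₂
      exact ⟨h.preservesHom, h⟩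
  · intro D₁ D₂ μ₁ μ₂ hD₁ hD₂ hμ
    -- The product applies `D₂` first, hence the order of the two lifts.
    have h : P.HasHomogeneousLift (S.onReg (D₁ * D₂)) :=
      (hD₂.hasHomogeneousLift P hθ₂0 per₂).trans (hD₁.hasHomogeneousLift P hθ₁0 per₁)
    exact ⟨hD₁.isPseudoAnosov_mul hne hμ hD₂, h.preservesHom, h⟩
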